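/- Let $k$ be a field, $n\ge 2$ and $g=(a_{ij})\in \mathrm{GL}_n(k)$. Let $\mathcal S=\mathcal S(k^n,g)$ be the $(2n+4)$-dimensional $\mathbb Z$-graded $k$-algebra with basis $e_X,e_Y,\alpha_1,\dots,\alpha_n$ in degree $0$ and $\beta_1,\dots,\beta_n,\xi_X,\xi_Y$ in degree $1$, i.e. the total morphism algebra of the graded category with two objects $X,Y$, identities $e_X,e_Y$, $\alpha_i\in\mathrm{Hom}(X,Y)$, $\beta_i\in\mathrm{Hom}(Y,X)$, $\xi_X\in\mathrm{Hom}(X,X)$, $\xi_Y\in\mathrm{Hom}(Y,Y)$, in which the product is the composition and the only nonzero products of basis elements not involving $e_X,e_Y$ are given by $$\beta_i\alpha_j=a_{ij}\,\xi_X,\qquad \alpha_j\beta_i=\delta_{ij}\,\xi_Y .$$ For a $\mathbb Z$-graded $k$-algebra $A$ let $CH^{s+t}(A)\{t\}$ ($s\ge 0$, $t\in\mathbb Z$) be the space of $k$-linear maps $A^{\otimes s}\to A$ of degree $t$, with the Hochschild differential (with Koszul signs) $$(\delta f)(a_0,\dots,a_s)=(-1)^{t\deg a_0}a_0f(a_1,\dots,a_s)+\sum_{i=0}^{s-1}(-1)^{i+1}f(a_0,\dots,a_ia_{i+1},\dots,a_s)+(-1)^{s+1}f(a_0,\dots,a_{s-1})a_s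 ,$$ and let $HH^{m}(A)\{t\}$ be the cohomology of $CH^{\bullet}(A)\{t\}$ at $CH^m(A)\{t\}$ (zero if $m<t$). Then for all $m,t\in\mathbb Z$ with $t<-m$ one has $$HH^m(\mathcal S)\{t\}=0 .$$ If in addition $n\ge 3$, or $g\ne\lambda\cdot\mathrm{id}$ for every $\lambda\in k^*$, or $\mathrm{char}(k)\ne 2$, then $$HH^1(\mathcal S)\{-1\}=0 .$$ -/

import Mathlib

set_option maxSynthPendingDepth 3

/-- The total morphism algebra of the graded category with two objects `X`, `Y`, where
`Hom(X,Y) = V`, `Hom(Y,X) = V^∨`, `Hom(X,X) = R id_X ⊕ R ξ_X`, `Hom(Y,Y) = R id_Y ⊕ R ξ_Y`,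
attached to an endomorphism `g` of `V`. -/
@[ext]
structure SphAlg {R V : Type*} [CommRing R] [AddCommGroup V] [Module R V] (g : V →ₗ[R] V) where
  /-- coefficient of `id_X` -/
  idX : R
  /-- coefficient of `id_Y` -/
  idY : R
  /-- component in `Hom(X,Y) = V` -/
  hXY : V
  /-- component in `Hom(Y,X) = V^∨` -/
  hYX : Module.Dual R V
  /-- coefficient of `ξ_X` -/
  xiX : R
  /-- coefficient of `ξ_Y` -/
  xiY : R

namespace SphAlg

variable {R V : Type*} [CommRing R] [AddCommGroup V] [Module R V] {g : V →ₗ[R] V}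

instance : Zero (SphAlg g) := ⟨⟨0, 0, 0, 0, 0, 0⟩⟩
instance : Add (SphAlg g) := ⟨fun a b =>
  ⟨a.idX + b.idX, a.idY + b.idY, a.hXY + b.hXY, a.hYX + b.hYX, a.xiX + b.xiX, a.xiY + b.xiY⟩⟩
instance : Neg (SphAlg g) := ⟨fun a => ⟨-a.idX, -a.idY, -a.hXY, -a.hYX, -a.xiX, -a.xiY⟩⟩
instance : SMul R (SphAlg g) := ⟨fun r a =>
  ⟨r * a.idX, r * a.idY, r • a.hXY, r • a.hYX, r * a.xiX, r * a.xiY⟩⟩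
instance : One (SphAlg g) := ⟨⟨1, 1, 0, 0, 0, 0⟩⟩

/-- The product `a * b` is the composition `a ∘ b` (first `b`, then `a`), with
`v^* ∘ v = ⟨v^*, g v⟩ ξ_X` and `v ∘ v^* = ⟨v^*, v⟩ ξ_Y`. -/
instance : Mul (SphAlg g) := ⟨fun a b =>
  { idX := a.idX * b.idX
    idY := a.idY * b.idY
    hXY := a.idY • b.hXY + b.idX • a.hXY
    hYX := a.idX • b.hYX + b.idY • a.hYX
    xiX := a.idX * b.xiX + a.xiX * b.idX + a.hYX (g b.hXY)
    xiY := a.idY * b.xiY + a.xiY * b.idY + b.hYX a.hXY }⟩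

@[simp] lemma zero_idX : (0 : SphAlg g).idX = 0 := rfl
@[simp] lemma zero_idY : (0 : SphAlg g).idY = 0 := rfl
@[simp] lemma zero_hXY : (0 : SphAlg g).hXY = 0 := rfl
@[simp] lemma zero_hYX : (0 : SphAlg g).hYX = 0 := rfl
@[simp] lemma zero_xiX : (0 : SphAlg g).xiX = 0 := rfl
@[simp] lemma zero_xiY : (0 : SphAlg g).xiY = 0 := rfl
@[simp] lemma one_idX : (1 : SphAlg g).idX = 1 := rfl
@[simp] lemma one_idY : (1 : SphAlg g).idY = 1 := rfl
@[simp] lemma one_hXY : (1 : SphAlg g).hXY = 0 := rfl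
@[simp] lemma one_hYX : (1 : SphAlg g).hYX = 0 := rfl
@[simp] lemma one_xiX : (1 : SphAlg g).xiX = 0 := rfl
@[simp] lemma one_xiY : (1 : SphAlg g).xiY = 0 := rfl
@[simp] lemma add_idX (a b : SphAlg g) : (a + b).idX = a.idX + b.idX := rfl
@[simp] lemma add_idY (a b : SphAlg g) : (a + b).idY = a.idY + b.idY := rfl
@[simp] lemma add_hXY (a b : SphAlg g) : (a + b).hXY = a.hXY + b.hXY := rfl
@[simp] lemma add_hYX (a b : SphAlg g) : (a + b).hYX = a.hYX + b.hYX := rfl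
@[simp] lemma add_xiX (a b : SphAlg g) : (a + b).xiX = a.xiX + b.xiX := rfl
@[simp] lemma add_xiY (a b : SphAlg g) : (a + b).xiY = a.xiY + b.xiY := rfl
@[simp] lemma neg_idX (a : SphAlg g) : (-a).idX = -a.idX := rfl
@[simp] lemma neg_idY (a : SphAlg g) : (-a).idY = -a.idY := rfl
@[simp] lemma neg_hXY (a : SphAlg g) : (-a).hXY = -a.hXY := rfl
@[simp] lemma neg_hYX (a : SphAlg g) : (-a).hYX = -a.hYX := rfl
@[simp] lemma neg_xiX (a : SphAlg g) : (-a).xiX = -a.xiX := rfl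
@[simp] lemma neg_xiY (a : SphAlg g) : (-a).xiY = -a.xiY := rfl
@[simp] lemma smul_idX (r : R) (a : SphAlg g) : (r • a).idX = r * a.idX := rfl
@[simp] lemma smul_idY (r : R) (a : SphAlg g) : (r • a).idY = r * a.idY := rfl
@[simp] lemma smul_hXY (r : R) (a : SphAlg g) : (r • a).hXY = r • a.hXY := rfl
@[simp] lemma smul_hYX (r : R) (a : SphAlg g) : (r • a).hYX = r • a.hYX := rfl
@[simp] lemma smul_xiX (r : R) (a : SphAlg g) : (r • a).xiX = r * a.xiX := rfl
@[simp] lemma smul_xiY (r : R) (a : SphAlg g) : (r • a).xiY = r * a.xiY := rfl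
@[simp] lemma mul_idX (a b : SphAlg g) : (a * b).idX = a.idX * b.idX := rfl
@[simp] lemma mul_idY (a b : SphAlg g) : (a * b).idY = a.idY * b.idY := rfl
@[simp] lemma mul_hXY (a b : SphAlg g) : (a * b).hXY = a.idY • b.hXY + b.idX • a.hXY := rfl
@[simp] lemma mul_hYX (a b : SphAlg g) : (a * b).hYX = a.idX • b.hYX + b.idY • a.hYX := rfl
@[simp] lemma mul_xiX (a b : SphAlg g) :
    (a * b).xiX = a.idX * b.xiX + a.xiX * b.idX + a.hYX (g b.hXY) := rfl
@[simp] lemma mul_xiY (a b : SphAlg g) :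
    (a * b).xiY = a.idY * b.xiY + a.xiY * b.idY + b.hYX a.hXY := rfl

instance : AddCommGroup (SphAlg g) where
  add_assoc a b c := by ext <;> simp [add_assoc]
  zero_add a := by ext <;> simp
  add_zero a := by ext <;> simp
  add_comm a b := by ext <;> simp [add_comm]
  neg_add_cancel a := by ext <;> simp
  nsmul := nsmulRec
  zsmul := zsmulRec

instance : Ring (SphAlg g) where
  left_distrib a b c := by ext <;> simp <;> first | ring | module
  right_distrib a b c := by ext <;> simp <;> first | ring | module
  zero_mul a := by ext <;> simp
  mul_zero a := by ext <;> simp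
  one_mul a := by ext <;> simp
  mul_one a := by ext <;> simp
  mul_assoc a b c := by ext <;> simp <;> first | ring | module
  zsmul := zsmulRec
  neg_add_cancel a := neg_add_cancel a

instance : Module R (SphAlg g) where
  one_smul a := by ext <;> simp
  mul_smul r s a := by ext <;> simp [mul_assoc, mul_smul]
  smul_zero r := by ext <;> simp
  smul_add r a b := by ext <;> simp [mul_add]
  add_smul r s a := by ext <;> simp [add_mul, add_smul]
  zero_smul a := by ext <;> simp

instance : Algebra R (SphAlg g) :=
  Algebra.ofModule
    (fun r a b => by ext <;> simp <;> first | ring | module)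
    (fun r a b => by ext <;> simp <;> first | ring | module)

/-- The grading by morphism degree: `Hom^0` is spanned by `id_X`, `id_Y` and `Hom(X,Y)`,
`Hom^1` by `Hom(Y,X)`, `ξ_X` and `ξ_Y`, and there is nothing in other degrees. -/
def grading (g : V →ₗ[R] V) (d : ℤ) : Submodule R (SphAlg g) where
  carrier := {a | (d ≠ 0 → a.idX = 0 ∧ a.idY = 0 ∧ a.hXY = 0) ∧
    (d ≠ 1 → a.hYX = 0 ∧ a.xiX = 0 ∧ a.xiY = 0)}
  zero_mem' := by simp
  add_mem' := by
    rintro a b ⟨ha, ha'⟩ ⟨hb, hb'⟩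
    refine ⟨fun h => ?_, fun h => ?_⟩
    · simp [ha h, hb h]
    · simp [ha' h, hb' h]
  smul_mem' := by
    rintro r a ⟨ha, ha'⟩
    refine ⟨fun h => ?_, fun h => ?_⟩
    · simp [ha h]
    · simp [ha' h]

lemma mem_grading {d : ℤ} {a : SphAlg g} : a ∈ grading g d ↔
    (d ≠ 0 → a.idX = 0 ∧ a.idY = 0 ∧ a.hXY = 0) ∧
    (d ≠ 1 → a.hYX = 0 ∧ a.xiX = 0 ∧ a.xiY = 0) := Iff.rfl

/-- The degree `0` part of an element. -/
def part0 (g : V →ₗ[R] V) : SphAlg g →ₗ[R] grading g 0 where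
  toFun a := ⟨⟨a.idX, a.idY, a.hXY, 0, 0, 0⟩, by simp [mem_grading]⟩
  map_add' a b := by ext <;> simp
  map_smul' r a := by ext <;> simp

/-- The degree `1` part of an element. -/
def part1 (g : V →ₗ[R] V) : SphAlg g →ₗ[R] grading g 1 where
  toFun a := ⟨⟨0, 0, 0, a.hYX, a.xiX, a.xiY⟩, by simp [mem_grading]⟩
  map_add' a b := by ext <;> simp
  map_smul' r a := by ext <;> simp

instance : SetLike.GradedMonoid (grading g) where
  one_mem := by simp [mem_grading]
  mul_mem := by
    intro i j a b ha hb
    rw [mem_grading] at *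
    by_cases hi0 : i = 0 <;> by_cases hi1 : i = 1 <;> by_cases hj0 : j = 0 <;>
      by_cases hj1 : j = 1 <;> simp_all

instance : DirectSum.Decomposition (grading g) :=
  DirectSum.Decomposition.ofLinearMap (grading g)
    (DirectSum.lof R ℤ (fun d => grading g d) 0 ∘ₗ part0 g +
      DirectSum.lof R ℤ (fun d => grading g d) 1 ∘ₗ part1 g)
    (by
      ext a <;> simp [part0, part1])
    (by
      refine DirectSum.linearMap_ext _ fun d => ?_
      ext1 ⟨a, ha⟩
      rw [mem_grading] at ha
      simp only [LinearMap.comp_apply, LinearMap.add_apply, DirectSum.coeLinearMap_lof,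
        LinearMap.id_apply]
      by_cases h0 : d = 0
      · subst h0
        have h : part1 g a = 0 := by ext <;> simp [part1, ha.2 (by simp)]
        have h' : part0 g a = ⟨a, ha⟩ := by ext <;> simp [part0, ha.2 (by simp)]
        rw [h, h', map_zero, add_zero]
      · by_cases h1 : d = 1
        · subst h1
          have h : part0 g a = 0 := by ext <;> simp [part0, ha.1 (by simp)]
          have h' : part1 g a = ⟨a, ha⟩ := by ext <;> simp [part1, ha.1 (by simp)]
          rw [h, h', map_zero, zero_add]
        · have h : part0 g a = 0 := by ext <;> simp [part0, ha.1 h0]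
          have h' : part1 g a = 0 := by ext <;> simp [part1, ha.2 h1]
          have h2 : (⟨a, ha⟩ : grading g d) = 0 := by
            ext <;> simp [ha.1 h0, ha.2 h1]
          rw [h, h', h2, map_zero, map_zero, map_zero, add_zero])

instance : GradedAlgebra (grading g) where

end SphAlg

namespace Hochschild

section

variable {k A : Type*} [CommRing k] [Ring A] [Algebra k A]

/-- All `k`-linear maps `A^{⊗ s} → A`. -/
abbrev Cochain (k A : Type*) [CommRing k] [Ring A] [Algebra k A] (s : ℕ) :=
  MultilinearMap k (fun _ : Fin s => A) A

/-- For `A = ⨁ 𝒜 d`, the `k`-linear map which is multiplication by `(-1)^{t d}` on `𝒜 d`. -/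
def koszulSign (𝒜 : ℤ → Submodule k A) [GradedAlgebra 𝒜] (t : ℤ) : A →ₗ[k] A :=
  DirectSum.toModule k ℤ A (fun d => ((t * d).negOnePow : ℤ) • (𝒜 d).subtype) ∘ₗ
    (DirectSum.decomposeLinearEquiv 𝒜).toLinearMap

lemma koszulSign_apply (𝒜 : ℤ → Submodule k A) [GradedAlgebra 𝒜] (t : ℤ) {d : ℤ} {a : A}
    (ha : a ∈ 𝒜 d) : koszulSign 𝒜 t a = ((t * d).negOnePow : ℤ) • a := by
  simp only [koszulSign, LinearMap.comp_apply, LinearEquiv.coe_coe,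
    DirectSum.decomposeLinearEquiv_apply, DirectSum.decompose_of_mem 𝒜 ha]
  exact DirectSum.toModule_lof (M := fun d => 𝒜 d) k d ⟨a, ha⟩

lemma koszulSign_mul (𝒜 : ℤ → Submodule k A) [GradedAlgebra 𝒜] (t : ℤ) (a b : A) :
    koszulSign 𝒜 t (a * b) = koszulSign 𝒜 t a * koszulSign 𝒜 t b := by
  induction a using DirectSum.Decomposition.inductionOn 𝒜 with
  | zero => simp
  | add a a' h h' => simp [add_mul, h, h']
  | @homogeneous d a =>
    induction b using DirectSum.Decomposition.inductionOn 𝒜 with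
    | zero => simp
    | add b b' h h' => simp [mul_add, h, h']
    | @homogeneous e b =>
      rw [koszulSign_apply 𝒜 t a.2, koszulSign_apply 𝒜 t b.2,
        koszulSign_apply 𝒜 t (SetLike.mul_mem_graded a.2 b.2), mul_add, Int.negOnePow_add,
        Units.val_mul, smul_mul_smul_comm]

lemma contractNth_update {s : ℕ} (i : Fin s) (a : Fin (s + 1) → A) (j : Fin (s + 1)) :
    ∃ (p : Fin s) (L : A →ₗ[k] A), ∀ x,
      i.castSucc.contractNth (· * ·) (Function.update a j x) =
        Function.update (i.castSucc.contractNth (· * ·) a) p (L x) := by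
  have hi := i.2
  have hj := j.2
  rcases lt_trichotomy (j : ℕ) i with h | h | h
  · refine ⟨⟨j, by lia⟩, LinearMap.id, fun x => ?_⟩
    funext q
    simp only [Fin.contractNth, Function.update_apply, Fin.ext_iff, Fin.val_castSucc, Fin.val_succ,
      LinearMap.id_apply]
    grind
  · refine ⟨i, LinearMap.mulRight k (a i.succ), fun x => ?_⟩
    funext q
    simp only [Fin.contractNth, Function.update_apply, Fin.ext_iff, Fin.val_castSucc, Fin.val_succ,
      LinearMap.mulRight_apply]
    rcases lt_trichotomy (q : ℕ) i with h' | h' | h'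
    · grind
    · obtain rfl := Fin.ext h'
      simp [h]
    · grind
  · by_cases h2 : (j : ℕ) = i + 1
    · refine ⟨i, LinearMap.mulLeft k (a i.castSucc), fun x => ?_⟩
      funext q
      simp only [Fin.contractNth, Function.update_apply, Fin.ext_iff, Fin.val_castSucc,
        Fin.val_succ, LinearMap.mulLeft_apply]
      rcases lt_trichotomy (q : ℕ) i with h' | h' | h'
      · grind
      · obtain rfl := Fin.ext h'
        simp [h2]
      · grind
    · refine ⟨⟨j - 1, by lia⟩, LinearMap.id, fun x => ?_⟩
      funext q
      simp only [Fin.contractNth, Function.update_apply, Fin.ext_iff, Fin.val_castSucc,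
        Fin.val_succ, LinearMap.id_apply]
      grind

/-- `(a₀, …, a_s) ↦ (-1)^{t |a₀|} a₀ f(a₁, …, a_s)`. -/
def firstFace (𝒜 : ℤ → Submodule k A) [GradedAlgebra 𝒜] (t : ℤ) {s : ℕ} (f : Cochain k A s) :
    Cochain k A (s + 1) :=
  LinearMap.uncurryLeft (R := k) (M := fun _ : Fin (s + 1) => A)
    { toFun := fun a => (LinearMap.mulLeft k (koszulSign 𝒜 t a)).compMultilinearMap f
      map_add' := fun a b => by ext; simp [add_mul]
      map_smul' := fun r a => by ext; simp }

/-- `(a₀, …, a_s) ↦ f(a₀, …, a_i a_{i+1}, …, a_s)`. -/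
def innerFace {s : ℕ} (i : Fin s) (f : Cochain k A s) : Cochain k A (s + 1) :=
  MultilinearMap.mk' (fun a => f (i.castSucc.contractNth (· * ·) a))
    (fun a j x y => by
      obtain ⟨p, L, h⟩ := contractNth_update (k := k) i a j
      simp [h])
    (fun a j c x => by
      obtain ⟨p, L, h⟩ := contractNth_update (k := k) i a j
      simp [h])

/-- `(a₀, …, a_s) ↦ f(a₀, …, a_{s-1}) a_s`. -/
def lastFace {s : ℕ} (f : Cochain k A s) : Cochain k A (s + 1) :=
  MultilinearMap.uncurryRight (R := k) (M := fun _ : Fin (s + 1) => A)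
    ((LinearMap.mul k A).compMultilinearMap f)

lemma firstFace_apply (𝒜 : ℤ → Submodule k A) [GradedAlgebra 𝒜] (t : ℤ) {s : ℕ}
    (f : Cochain k A s) (a : Fin (s + 1) → A) :
    firstFace 𝒜 t f a = koszulSign 𝒜 t (a 0) * f (fun i => a i.succ) := rfl

lemma innerFace_apply {s : ℕ} (i : Fin s) (f : Cochain k A s) (a : Fin (s + 1) → A) :
    innerFace i f a = f (i.castSucc.contractNth (· * ·) a) := rfl

lemma lastFace_apply {s : ℕ} (f : Cochain k A s) (a : Fin (s + 1) → A) :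
    lastFace f a = f (fun i => a i.castSucc) * a (Fin.last s) := rfl

/-- The Hochschild differential on cochains of internal degree `t`, with Koszul signs:
`(δf)(a₀, …, a_s) = (-1)^{t |a₀|} a₀ f(a₁, …, a_s)
  + ∑_{i < s} (-1)^{i+1} f(a₀, …, a_i a_{i+1}, …, a_s) + (-1)^{s+1} f(a₀, …, a_{s-1}) a_s`. -/
def differential (𝒜 : ℤ → Submodule k A) [GradedAlgebra 𝒜] (t : ℤ) (s : ℕ) :
    Cochain k A s →ₗ[k] Cochain k A (s + 1) where
  toFun f := firstFace 𝒜 t f + ∑ i : Fin s, (-1 : ℤ) ^ ((i : ℕ) + 1) • innerFace i f +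
    (-1 : ℤ) ^ (s + 1) • lastFace f
  map_add' f f' := by
    ext a
    simp only [add_apply, sum_apply, smul_apply,
      firstFace_apply, innerFace_apply, lastFace_apply, mul_add, add_mul, smul_add,
      Finset.sum_add_distrib]
    abel
  map_smul' c f := by
    ext a
    simp only [add_apply, sum_apply, smul_apply,
      firstFace_apply, innerFace_apply, lastFace_apply, RingHom.id_apply, smul_add,
      Finset.smul_sum, mul_smul_comm, smul_mul_assoc, smul_comm c]

/-- The space `CH^{s+t}(A){t}` of `k`-linear maps `A^{⊗ s} → A` of degree `t`. -/
def homogeneousCochains (𝒜 : ℤ → Submodule k A) (t : ℤ) (s : ℕ) : Submodule k (Cochain k A s) where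
  carrier := {f | ∀ (d : Fin s → ℤ) (a : Fin s → A), (∀ i, a i ∈ 𝒜 (d i)) →
    f a ∈ 𝒜 (∑ i, d i + t)}
  zero_mem' _ _ _ := zero_mem _
  add_mem' hf hf' d a h := add_mem (hf d a h) (hf' d a h)
  smul_mem' c _ hf d a h := Submodule.smul_mem _ c (hf d a h)

/-- Cocycles among the linear maps `A^{⊗ s} → A` of degree `t`. -/
def cocycles (𝒜 : ℤ → Submodule k A) [GradedAlgebra 𝒜] (t : ℤ) (s : ℕ) :
    Submodule k (Cochain k A s) :=
  homogeneousCochains 𝒜 t s ⊓ LinearMap.ker (differential 𝒜 t s)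

/-- Coboundaries of linear maps `A^{⊗ (s-1)} → A` of degree `t`; zero if `s = 0`. -/
def coboundaries (𝒜 : ℤ → Submodule k A) [GradedAlgebra 𝒜] (t : ℤ) :
    (s : ℕ) → Submodule k (Cochain k A s)
  | 0 => ⊥
  | s + 1 => (homogeneousCochains 𝒜 t s).map (differential 𝒜 t s)

/-- The piece of Hochschild cohomology of the graded algebra `A = ⨁ 𝒜 d` that comes from linear
maps `A^{⊗ s} → A` of degree `t`. -/
abbrev cohomology (𝒜 : ℤ → Submodule k A) [GradedAlgebra 𝒜] (t : ℤ) (s : ℕ) :=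
  cocycles 𝒜 t s ⧸ (coboundaries 𝒜 t s).submoduleOf (cocycles 𝒜 t s)

/-- `HH^m(A){t}`: the cohomology at the linear maps `A^{⊗ s} → A` of degree `t` with `s + t = m`;
it is zero if `m - t` is negative. -/
def HH (𝒜 : ℤ → Submodule k A) [GradedAlgebra 𝒜] (m t : ℤ) : Type _ :=
  match m - t with
  | Int.ofNat s => cohomology 𝒜 t s
  | Int.negSucc _ => PUnit

/-! The differential squares to zero and preserves the internal degree. -/

/-- All faces, numbered from `0` to `s + 1`. -/
def face (𝒜 : ℤ → Submodule k A) [GradedAlgebra 𝒜] (t : ℤ) {s : ℕ} (i : Fin (s + 2))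
    (f : Cochain k A s) : Cochain k A (s + 1) :=
  Fin.cases (firstFace 𝒜 t f) (Fin.lastCases (lastFace f) (fun j => innerFace j f)) i

lemma face_zero (𝒜 : ℤ → Submodule k A) [GradedAlgebra 𝒜] (t : ℤ) {s : ℕ} (f : Cochain k A s) :
    face 𝒜 t 0 f = firstFace 𝒜 t f := rfl

lemma face_inner (𝒜 : ℤ → Submodule k A) [GradedAlgebra 𝒜] (t : ℤ) {s : ℕ} (f : Cochain k A s)
    (i : Fin s) : face 𝒜 t i.castSucc.succ f = innerFace i f := by
  simp only [face, Fin.cases_succ, Fin.lastCases_castSucc]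

lemma face_last (𝒜 : ℤ → Submodule k A) [GradedAlgebra 𝒜] (t : ℤ) {s : ℕ} (f : Cochain k A s) :
    face 𝒜 t (Fin.last s).succ f = lastFace f := by
  simp only [face, Fin.cases_succ, Fin.lastCases_last]

lemma differential_eq (𝒜 : ℤ → Submodule k A) [GradedAlgebra 𝒜] (t : ℤ) {s : ℕ}
    (f : Cochain k A s) :
    differential 𝒜 t s f = ∑ i : Fin (s + 2), (-1 : ℤ) ^ (i : ℕ) • face 𝒜 t i f := by
  rw [Fin.sum_univ_succ, Fin.sum_univ_castSucc]
  simp only [face_zero, face_inner, face_last, differential]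
  simp [add_assoc]

lemma contractNth_contractNth {s : ℕ} (p q : Fin s) (h : p ≤ q) (a : Fin (s + 2) → A) :
    p.castSucc.contractNth (· * ·) (q.succ.castSucc.contractNth (· * ·) a) =
      q.castSucc.contractNth (· * ·) (p.castSucc.castSucc.contractNth (· * ·) a) := by
  have h' : (p : ℕ) ≤ q := h
  funext r
  simp only [Fin.contractNth, Fin.val_castSucc, Fin.val_succ]
  split_ifs <;> first | lia | rfl | simp [mul_assoc]

lemma face_face (𝒜 : ℤ → Submodule k A) [GradedAlgebra 𝒜] (t : ℤ) {s : ℕ}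
    (f : Cochain k A s) (i j : Fin (s + 2)) (h : i ≤ j) :
    face 𝒜 t j.succ (face 𝒜 t i f) = face 𝒜 t i.castSucc (face 𝒜 t j f) := by
  ext a
  induction i using Fin.cases with
  | zero =>
    rw [Fin.castSucc_zero, face_zero, face_zero, firstFace_apply]
    induction j using Fin.cases with
    | zero =>
      have : (0 : Fin (s + 2)).succ = (0 : Fin (s + 1)).castSucc.succ := rfl
      rw [this, face_inner, face_zero, innerFace_apply, firstFace_apply, firstFace_apply,
        ← mul_assoc, ← koszulSign_mul]
      rfl
    | succ j =>
      induction j using Fin.lastCases with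
      | last =>
        rw [show (Fin.last s).succ.succ = (Fin.last (s + 1)).succ from rfl, face_last, face_last,
          lastFace_apply, lastFace_apply, firstFace_apply, mul_assoc]
        rfl
      | cast q =>
        rw [show q.castSucc.succ.succ = q.succ.castSucc.succ from rfl, face_inner, face_inner,
          innerFace_apply, innerFace_apply, firstFace_apply]
        congr 1
        congr 1
        funext r
        simp [Fin.contractNth]
  | succ i =>
    induction j using Fin.cases with
    | zero => simp at h
    | succ j =>
      have h' := Fin.succ_le_succ_iff.1 h
      induction j using Fin.lastCases with
      | last =>
        rw [face_last, show (Fin.last s).succ.succ = (Fin.last (s + 1)).succ from rfl, face_last,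
          lastFace_apply]
        induction i using Fin.lastCases with
        | last =>
          rw [face_last, show (Fin.last s).succ.castSucc = (Fin.last s).castSucc.succ from rfl,
            face_inner, innerFace_apply, lastFace_apply, lastFace_apply, mul_assoc]
          congr 1
          · congr 1
            funext r
            simp [Fin.contractNth]
          · simp [Fin.contractNth]
        | cast p =>
          rw [face_inner, show p.castSucc.succ.castSucc = p.castSucc.castSucc.succ from rfl,
            face_inner, innerFace_apply, innerFace_apply, lastFace_apply]
          congr 1
          simp only [Fin.contractNth, Fin.val_castSucc, Fin.val_last]
          have := p.2
          split_ifs <;> first | lia | rfl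
      | cast q =>
        induction i using Fin.lastCases with
        | last =>
          have := Fin.le_def.1 h'
          simp at this
          have := q.2
          lia
        | cast p =>
          rw [show q.castSucc.succ.succ = q.succ.castSucc.succ from rfl, face_inner, face_inner,
            show p.castSucc.succ.castSucc = p.castSucc.castSucc.succ from rfl, face_inner,
            face_inner]
          simp only [innerFace_apply]
          rw [contractNth_contractNth p q h']

theorem differential_differential (𝒜 : ℤ → Submodule k A) [GradedAlgebra 𝒜] (t : ℤ) {s : ℕ}
    (f : Cochain k A s) : differential 𝒜 t (s + 1) (differential 𝒜 t s f) = 0 := by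
  have hf (j : Fin (s + 3)) : face 𝒜 t j (differential 𝒜 t s f) =
      ∑ i : Fin (s + 2), (-1 : ℤ) ^ (i : ℕ) • face 𝒜 t j (face 𝒜 t i f) := by
    rw [differential_eq]
    ext a
    induction j using Fin.cases with
    | zero =>
      simp only [face_zero, firstFace_apply, sum_apply, smul_apply, Finset.mul_sum,
        mul_smul_comm]
    | succ j =>
      induction j using Fin.lastCases with
      | last => simp only [face_last, lastFace_apply, sum_apply, smul_apply, Finset.sum_mul,
          smul_mul_assoc]
      | cast q => simp only [face_inner, innerFace_apply, sum_apply, smul_apply]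
  rw [differential_eq]
  simp only [hf, Finset.smul_sum, smul_smul]
  rw [← Finset.sum_product', Finset.univ_product_univ]
  let P := Fin (s + 3) × Fin (s + 2)
  let S : Finset P := {x : P | (x.1 : ℕ) ≤ (x.2 : ℕ)}
  rw [← Finset.sum_add_sum_compl S, ← eq_neg_iff_add_eq_zero, ← Finset.sum_neg_distrib]
  refine Finset.sum_bij
    (fun x hx => (x.2.succ, x.1.castLT (lt_of_le_of_lt (Finset.mem_filter.mp hx).2 x.2.2)))
    ?_ ?_ ?_ ?_
  · intro x hx
    simp only [S, Finset.mem_filter_univ, Finset.mem_compl, Fin.val_succ, Fin.val_castLT] at hx ⊢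
    lia
  · rintro ⟨i, j⟩ hx ⟨i', j'⟩ hx' h
    have h1 := congrArg (fun x => (x.1 : ℕ)) h
    have h2 := congrArg (fun x => (x.2 : ℕ)) h
    simp only [Fin.val_succ, Fin.val_castLT] at h1 h2
    exact Prod.ext (Fin.ext h2) (Fin.ext (by lia))
  · rintro ⟨i, j⟩ hx
    simp only [S, Finset.mem_filter_univ, Finset.mem_compl, not_le] at hx
    have := i.2
    refine ⟨(j.castSucc, ⟨i - 1, by lia⟩), ?_, ?_⟩
    · simp only [S, Finset.mem_filter_univ, Fin.val_castSucc]
      lia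
    · refine Prod.ext (Fin.ext ?_) rfl
      simp only [Fin.val_succ]
      lia
  · rintro ⟨i, j⟩ hx
    simp only [S, Finset.mem_filter_univ] at hx
    have := face_face 𝒜 t f (i.castLT (lt_of_le_of_lt hx j.2)) j hx
    simp only [this, Fin.castSucc_castLT, Fin.val_succ, Fin.val_castLT, ← neg_smul]
    congr 1
    ring

lemma sum_contractNth {s : ℕ} (p : Fin s) (d : Fin (s + 1) → ℤ) :
    ∑ i, p.castSucc.contractNth (· + ·) d i = ∑ i, d i := by
  induction s with
  | zero => exact p.elim0
  | succ s ih =>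
    rw [Fin.sum_univ_succ, Fin.sum_univ_succ d]
    induction p using Fin.cases with
    | zero =>
      rw [Fin.sum_univ_succ (fun i : Fin (s + 1) => d i.succ), ← add_assoc]
      congr 1
    | succ p =>
      rw [← ih p (fun i => d i.succ)]
      congr 1
      refine Finset.sum_congr rfl fun i _ => ?_
      simp [Fin.contractNth]

lemma differential_mem (𝒜 : ℤ → Submodule k A) [GradedAlgebra 𝒜] (t : ℤ) {s : ℕ}
    {f : Cochain k A s} (hf : f ∈ homogeneousCochains 𝒜 t s) :
    differential 𝒜 t s f ∈ homogeneousCochains 𝒜 t (s + 1) := by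
  rw [differential_eq]
  refine Submodule.sum_mem _ fun i _ => zsmul_mem ?_ _
  intro d a h
  induction i using Fin.cases with
  | zero =>
    rw [face_zero, firstFace_apply, koszulSign_apply 𝒜 t (h 0), Fin.sum_univ_succ, add_assoc]
    exact SetLike.mul_mem_graded (zsmul_mem (h 0) _) (hf (fun i => d i.succ) _ fun i => h i.succ)
  | succ i =>
    induction i using Fin.lastCases with
    | last =>
      rw [face_last, lastFace_apply, Fin.sum_univ_castSucc, add_right_comm]
      exact SetLike.mul_mem_graded (hf (fun i => d i.castSucc) _ fun i => h i.castSucc) (h _)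
    | cast p =>
      rw [face_inner, innerFace_apply]
      have hd : ∑ i, d i = ∑ i, p.castSucc.contractNth (· + ·) d i := (sum_contractNth p d).symm
      rw [hd]
      refine hf _ _ fun q => ?_
      simp only [Fin.contractNth]
      split_ifs
      · exact h _
      · exact SetLike.mul_mem_graded (h _) (h _)
      · exact h _

theorem coboundaries_le_cocycles (𝒜 : ℤ → Submodule k A) [GradedAlgebra 𝒜] (t : ℤ) (s : ℕ) :
    coboundaries 𝒜 t s ≤ cocycles 𝒜 t s := by
  cases s with
  | zero => exact bot_le
  | succ s =>
    rintro _ ⟨f, hf, rfl⟩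
    exact ⟨differential_mem 𝒜 t hf, differential_differential 𝒜 t f⟩

end

end Hochschild

/-!
Hochschild cochains of degree `t` are cochains of degree `0` with coefficients in the bimodule
`A = 𝒮(V, g)`, shifted by `t`. This bimodule is filtered by sub-bimodules whose subquotients are
multiples of one-dimensional ones, on which `A` acts from either side by one of its two characters,
the coefficients of `e_X` and `e_Y`.

The cohomology of the one-dimensional bimodules is computed by dimension shifting. The dual of the
left regular module is relatively injective, and it is filtered by the annihilators `R(H, K)^⊥` of
the left ideals `R(H, K)` spanned by `H ⊆ V`, `K ⊆ V^∨`, `ξ_X` and `ξ_Y`. Right multiplication by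
`u = v₀ + φ₀` identifies `A / R(ker φ₀, (g v₀)^⊥)` with `R(k v₀, k φ₀)` and shifts the degree, and
both kernels are nonzero as `dim V ≥ 2`; this gives an induction on the cochain degree. Hence
`HH^m(A){t}` is zero unless `m + t ∈ {0, 1, 2}`.

For `m = 1` and `t = -1`, the only obstructions are the `e_X`- and `e_Y`-components of a
`2`-cocycle `f`. If `f(φ, v)` has `e_X`-component `β φ v` and `f(v, φ)` has `e_Y`-component
`γ φ v`, then the cocycle identities force `β φ v = c φ(g v)` and `γ φ v = c' φ(v)`, unless
`dim V = 2`, `g` is a scalar and `char k = 2`. Components of this form are coboundaries.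
-/

namespace Hochschild

universe u

variable {k A M M' : Type u} [CommRing k] [Ring A] [Algebra k A] [AddCommGroup M] [Module k M]
  [AddCommGroup M'] [Module k M']

/-- A graded bimodule, not necessarily unital, over the graded algebra `A = ⨁ 𝒜 d` on the
`k`-module `M`. The pieces `gr e` need not span `M`. -/
structure GradedBimodule (𝒜 : ℤ → Submodule k A) (M : Type u) [AddCommGroup M] [Module k M] where
  /-- the left action `m ↦ a m` -/
  left : A →ₗ[k] M →ₗ[k] M
  /-- the right action `m ↦ m a` -/
  right : A →ₗ[k] M →ₗ[k] M
  left_mul : ∀ a b m, left (a * b) m = left a (left b m)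
  right_mul : ∀ a b m, right (a * b) m = right b (right a m)
  left_right : ∀ a b m, left a (right b m) = right b (left a m)
  /-- the homogeneous pieces -/
  gr : ℤ → Submodule k M
  left_mem : ∀ {d e a m}, a ∈ 𝒜 d → m ∈ gr e → left a m ∈ gr (d + e)
  right_mem : ∀ {d e a m}, a ∈ 𝒜 d → m ∈ gr e → right a m ∈ gr (e + d)

lemma contractNth_snoc_castSucc {s : ℕ} (i : Fin s) (a : Fin (s + 1) → A) (x : A) :
    i.castSucc.castSucc.contractNth (· * ·) (Fin.snoc a x : Fin (s + 2) → A) =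
      (Fin.snoc (i.castSucc.contractNth (· * ·) a) x : Fin (s + 1) → A) := by
  funext r
  induction r using Fin.lastCases with
  | last =>
    rw [Fin.snoc_last, Fin.contractNth_apply_of_gt _ _ _ _ (by simp)]
    exact Fin.snoc_last (α := fun _ => A) x a
  | cast r =>
    rw [Fin.snoc_castSucc]
    simp only [Fin.contractNth, Fin.val_castSucc, ← Fin.castSucc_succ, Fin.snoc_castSucc]

lemma contractNth_snoc_last {s : ℕ} (a : Fin (s + 1) → A) (x : A) :
    (Fin.last s).castSucc.contractNth (· * ·) (Fin.snoc a x : Fin (s + 2) → A) =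
      (Fin.snoc (Fin.init a) (a (Fin.last s) * x) : Fin (s + 1) → A) := by
  funext r
  induction r using Fin.lastCases with
  | last =>
    rw [Fin.snoc_last, Fin.contractNth_apply_of_eq _ _ _ _ (by simp), Fin.succ_last]
    simp only [Fin.snoc_castSucc, Fin.snoc_last]
  | cast r =>
    rw [Fin.snoc_castSucc, Fin.contractNth_apply_of_lt _ _ _ _ (by simp)]
    exact Fin.snoc_castSucc (α := fun _ => A) x a r.castSucc

namespace GradedBimodule

variable {𝒜 : ℤ → Submodule k A}

/-- The cochains of internal degree `0` all of whose values lie in `W`. -/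
def cochains (B : GradedBimodule 𝒜 M) (W : Submodule k M) (s : ℕ) :
    Submodule k (MultilinearMap k (fun _ : Fin s => A) M) where
  carrier := {f | (∀ (d : Fin s → ℤ) (a : Fin s → A), (∀ i, a i ∈ 𝒜 (d i)) →
    f a ∈ B.gr (∑ i, d i)) ∧ ∀ a, f a ∈ W}
  zero_mem' := ⟨fun _ _ _ => zero_mem _, fun _ => zero_mem _⟩
  add_mem' hf hf' := ⟨fun d a h => add_mem (hf.1 d a h) (hf'.1 d a h),
    fun a => add_mem (hf.2 a) (hf'.2 a)⟩
  smul_mem' c _ hf := ⟨fun d a h => Submodule.smul_mem _ c (hf.1 d a h),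
    fun a => Submodule.smul_mem _ c (hf.2 a)⟩

/-- The linear map `L` preserves degrees. -/
def IsGradedMap (B : GradedBimodule 𝒜 M) (B' : GradedBimodule 𝒜 M') (L : M →ₗ[k] M') : Prop :=
  ∀ e, ∀ m ∈ B.gr e, L m ∈ B'.gr e

/-- `W` is stable under both actions. -/
structure IsSubbimodule (B : GradedBimodule 𝒜 M) (W : Submodule k M) : Prop where
  left_mem : ∀ a, ∀ m ∈ W, B.left a m ∈ W
  right_mem : ∀ a, ∀ m ∈ W, B.right a m ∈ W

/-- The linear map `L` commutes with both actions on elements of `W`. -/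
structure IsEquivariantOn (B : GradedBimodule 𝒜 M) (B' : GradedBimodule 𝒜 M') (L : M →ₗ[k] M')
    (W : Submodule k M) : Prop where
  map_left : ∀ a, ∀ m ∈ W, L (B.left a m) = B'.left a (L m)
  map_right : ∀ a, ∀ m ∈ W, L (B.right a m) = B'.right a (L m)

variable {B : GradedBimodule 𝒜 M} {B' : GradedBimodule 𝒜 M'} {W W₁ W₂ W₃ : Submodule k M}
  {W' W₁' W₂' : Submodule k M'} {s : ℕ}

lemma cochains_mono (h : W₁ ≤ W₂) : B.cochains W₁ s ≤ B.cochains W₂ s :=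
  fun _ hf => ⟨hf.1, fun a => h (hf.2 a)⟩

lemma comp_mem_cochains {L : M →ₗ[k] M'} (hL : B.IsGradedMap B' L) (hW : W ≤ W'.comap L)
    {f : MultilinearMap k (fun _ : Fin s => A) M} (hf : f ∈ B.cochains W s) :
    L.compMultilinearMap f ∈ B'.cochains W' s :=
  ⟨fun d a h => hL _ _ (hf.1 d a h), fun a => hW (hf.2 a)⟩

lemma IsEquivariantOn.mono {L : M →ₗ[k] M'} (hL : B.IsEquivariantOn B' L W₂) (h : W₁ ≤ W₂) :
    B.IsEquivariantOn B' L W₁ :=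
  ⟨fun a m hm => hL.map_left a m (h hm), fun a m hm => hL.map_right a m (h hm)⟩

variable [SetLike.GradedMul 𝒜]

/-- The bimodule `Hom_k(A, M)` for which Hochschild `(s+1)`-cochains with values in `M` are
`s`-cochains with values in `Hom_k(A, M)`, compatibly with the differentials:
`(aΨ)(x) = a Ψ(x)` and `(Ψa)(x) = Ψ(ax) - Ψ(a)x`. -/
def hom (B : GradedBimodule 𝒜 M) : GradedBimodule 𝒜 (A →ₗ[k] M) where
  left := LinearMap.mk₂ k (fun a Ψ => B.left a ∘ₗ Ψ) (fun a b Ψ => by ext; simp)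
    (fun c a Ψ => by ext; simp) (fun a Ψ Φ => by ext; simp) (fun c a Ψ => by ext; simp)
  right := LinearMap.mk₂ k (fun a Ψ => Ψ ∘ₗ LinearMap.mulLeft k a - B.right.flip (Ψ a))
    (fun a b Ψ => by ext; simp [add_mul, add_sub_add_comm]) (fun c a Ψ => by ext; simp [smul_sub])
    (fun a Ψ Φ => by ext; simp [add_sub_add_comm]) (fun c a Ψ => by ext; simp [smul_sub])
  left_mul a b Ψ := by ext; simp [B.left_mul]
  right_mul a b Ψ := by ext; simp [B.right_mul]
  left_right a b Ψ := by ext; simp [B.left_right]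
  gr e :=
    { carrier := {Ψ | ∀ d, ∀ a ∈ 𝒜 d, Ψ a ∈ B.gr (e + d)}
      zero_mem' := fun _ _ _ => zero_mem _
      add_mem' := fun h h' d a ha => add_mem (h d a ha) (h' d a ha)
      smul_mem' := fun c _ h d a ha => Submodule.smul_mem _ c (h d a ha) }
  left_mem ha hΨ d x hx := by
    rw [add_assoc]
    exact B.left_mem ha (hΨ d x hx)
  right_mem ha hΨ d x hx := by
    rw [add_assoc]
    refine sub_mem (hΨ _ _ (SetLike.mul_mem_graded ha hx)) ?_
    rw [← add_assoc]
    exact B.right_mem hx (hΨ _ _ ha)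

@[simp] lemma hom_left_apply (B : GradedBimodule 𝒜 M) (a x : A) (Ψ : A →ₗ[k] M) :
    B.hom.left a Ψ x = B.left a (Ψ x) := rfl

@[simp] lemma hom_right_apply (B : GradedBimodule 𝒜 M) (a x : A) (Ψ : A →ₗ[k] M) :
    B.hom.right a Ψ x = Ψ (a * x) - B.right x (Ψ a) := rfl

/-- The Hochschild differential with coefficients in `M`, computed by currying the last argument
until no argument is left. -/
def d {M : Type u} [AddCommGroup M] [Module k M] (B : GradedBimodule 𝒜 M) :
    (s : ℕ) → MultilinearMap k (fun _ : Fin s => A) M →ₗ[k]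
      MultilinearMap k (fun _ : Fin (s + 1) => A) M
  | 0 => MultilinearMap.ofSubsingletonₗ k k A M (0 : Fin 1) ∘ₗ (B.left.flip - B.right.flip) ∘ₗ
      (MultilinearMap.constLinearEquivOfIsEmpty k k (fun _ => A) M).symm.toLinearMap
  | s + 1 => (multilinearCurryRightEquiv k (fun _ => A) M).symm.toLinearMap ∘ₗ B.hom.d s ∘ₗ
      (multilinearCurryRightEquiv k (fun _ => A) M).toLinearMap

lemma d_zero_apply (B : GradedBimodule 𝒜 M) (f : MultilinearMap k (fun _ : Fin 0 => A) M)
    (a : Fin 1 → A) : B.d 0 f a = B.left (a 0) (f 0) - B.right (a 0) (f 0) := rfl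

lemma d_succ_apply (B : GradedBimodule 𝒜 M) {s : ℕ}
    (f : MultilinearMap k (fun _ : Fin (s + 1) => A) M) (a : Fin (s + 2) → A) :
    B.d (s + 1) f a = B.hom.d s f.curryRight (Fin.init a) (a (Fin.last _)) := rfl

lemma d_d {M : Type u} [AddCommGroup M] [Module k M] (B : GradedBimodule 𝒜 M) {s : ℕ}
    (f : MultilinearMap k (fun _ : Fin s => A) M) : B.d (s + 1) (B.d s f) = 0 := by
  induction s generalizing M with
  | zero =>
    ext a
    have h := B.hom.d_zero_apply (B.d 0 f).curryRight (Fin.init a)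
    rw [d_succ_apply, h]
    simp [MultilinearMap.curryRight_apply, d_zero_apply, B.left_mul, B.right_mul, B.left_right]
  | succ s ih =>
    ext a
    have h : (B.d (s + 1) f).curryRight = B.hom.d s f.curryRight :=
      MultilinearMap.curry_uncurryRight _
    rw [d_succ_apply, h, ih]
    rfl

lemma curryRight_mem_cochains {B : GradedBimodule 𝒜 M} {s : ℕ}
    {f : MultilinearMap k (fun _ : Fin (s + 1) => A) M} (hf : f ∈ B.cochains ⊤ (s + 1)) :
    f.curryRight ∈ B.hom.cochains ⊤ s := by
  refine ⟨fun d a ha e x hx => ?_, fun _ => trivial⟩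
  have h := hf.1 (Fin.snoc d e) (Fin.snoc a x) fun i => by
    induction i using Fin.lastCases <;> simp [ha, hx]
  simpa [Fin.sum_univ_castSucc] using h

lemma d_mem_cochains {M : Type u} [AddCommGroup M] [Module k M] {B : GradedBimodule 𝒜 M} {s : ℕ}
    {f : MultilinearMap k (fun _ : Fin s => A) M} (hf : f ∈ B.cochains ⊤ s) :
    B.d s f ∈ B.cochains ⊤ (s + 1) := by
  refine ⟨fun d a ha => ?_, fun _ => trivial⟩
  induction s generalizing M with
  | zero =>
    have h0 : f 0 ∈ B.gr 0 := by simpa using hf.1 0 0 (fun i => i.elim0)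
    rw [d_zero_apply]
    refine sub_mem ?_ ?_
    · simpa using B.left_mem (ha 0) h0
    · simpa using B.right_mem (ha 0) h0
  | succ s ih =>
    rw [Fin.sum_univ_castSucc, d_succ_apply]
    exact ih (curryRight_mem_cochains hf) _ _ (fun i => ha i.castSucc) _ _ (ha _)

lemma d_apply {M : Type u} [AddCommGroup M] [Module k M] (B : GradedBimodule 𝒜 M) {s : ℕ}
    (f : MultilinearMap k (fun _ : Fin s => A) M) (a : Fin (s + 1) → A) :
    B.d s f a = B.left (a 0) (f (Fin.tail a)) +
      ∑ i : Fin s, (-1 : ℤ) ^ ((i : ℕ) + 1) • f (i.castSucc.contractNth (· * ·) a) +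
      (-1 : ℤ) ^ (s + 1) • B.right (a (Fin.last s)) (f (Fin.init a)) := by
  induction s generalizing M with
  | zero =>
    rw [d_zero_apply, Subsingleton.elim (Fin.tail a) 0, Subsingleton.elim (Fin.init a) 0]
    simp [sub_eq_add_neg]
  | succ s ih =>
    induction a using Fin.snocCases with
    | snoc a x =>
      have htail : (Fin.snoc (Fin.tail a) x : Fin (s + 1) → A) =
          Fin.tail (Fin.snoc a x : Fin (s + 2) → A) := by
        conv_rhs => rw [← Fin.cons_self_tail a, ← Fin.cons_snoc_eq_snoc_cons, Fin.tail_cons]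
      have hzero : (Fin.snoc a x : Fin (s + 2) → A) 0 = a 0 := Fin.snoc_apply_zero _ _
      rw [d_succ_apply, ih, Fin.sum_univ_castSucc, contractNth_snoc_last]
      simp only [contractNth_snoc_castSucc, hom_left_apply, hom_right_apply,
        MultilinearMap.curryRight_apply, Fin.init_snoc, Fin.snoc_last, htail, hzero,
        Fin.snoc_init_self, LinearMap.add_apply, LinearMap.sum_apply,
        LinearMap.smul_apply, Fin.val_castSucc, Fin.val_last, smul_sub, pow_succ _ (s + 1)]
      module

/-- The `s`-cochains `d u` with `u` a cochain whose values lie in `W`; zero if `s = 0`. -/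
def coboundaries (B : GradedBimodule 𝒜 M) (W : Submodule k M) :
    (s : ℕ) → Submodule k (MultilinearMap k (fun _ : Fin s => A) M)
  | 0 => ⊥
  | s + 1 => (B.cochains W s).map (B.d s)

/-- For sub-bimodules `W₁ ≤ W₂` of `M`, this expresses the vanishing of the cohomology in
cochain degree `s` and internal degree `0` with coefficients in `W₂ / W₁`. -/
def AcyclicBetween (B : GradedBimodule 𝒜 M) (W₁ W₂ : Submodule k M) (s : ℕ) : Prop :=
  ∀ f ∈ B.cochains W₂ s, (∀ a, B.d s f a ∈ W₁) → f ∈ B.cochains W₁ s ⊔ B.coboundaries W₂ s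

lemma coboundaries_mono (h : W₁ ≤ W₂) : B.coboundaries W₁ s ≤ B.coboundaries W₂ s := by
  cases s with
  | zero => exact le_rfl
  | succ s => exact Submodule.map_mono (cochains_mono h)

lemma d_eq_zero_of_mem_coboundaries {f : MultilinearMap k (fun _ : Fin s => A) M}
    (hf : f ∈ B.coboundaries W s) : B.d s f = 0 := by
  cases s with
  | zero => rw [(Submodule.mem_bot k).1 hf, map_zero]
  | succ s =>
    obtain ⟨u, -, rfl⟩ := hf
    exact B.d_d u

lemma coboundaries_le_cochains (hW : B.IsSubbimodule W) :
    B.coboundaries W s ≤ B.cochains W s := by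
  cases s with
  | zero => exact bot_le
  | succ s =>
    rintro _ ⟨u, hu, rfl⟩
    refine ⟨(d_mem_cochains (cochains_mono le_top hu)).1, fun a => ?_⟩
    rw [d_apply]
    exact add_mem (add_mem (hW.left_mem _ _ (hu.2 _)) (sum_mem fun i _ => zsmul_mem (hu.2 _) _))
      (zsmul_mem (hW.right_mem _ _ (hu.2 _)) _)

lemma d_comp {L : M →ₗ[k] M'} (hL : B.IsEquivariantOn B' L W)
    {f : MultilinearMap k (fun _ : Fin s => A) M} (hf : ∀ a, f a ∈ W) :
    B'.d s (L.compMultilinearMap f) = L.compMultilinearMap (B.d s f) := by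
  ext a
  simp only [d_apply, LinearMap.compMultilinearMap_apply, map_add, map_sum, map_zsmul,
    hL.map_left _ _ (hf _), hL.map_right _ _ (hf _)]

lemma d_comp_eq_zero {L : M →ₗ[k] M'} (hL : B.IsEquivariantOn B' L W)
    {f : MultilinearMap k (fun _ : Fin s => A) M} (hf : ∀ a, f a ∈ W) (hdf : B.d s f = 0) :
    B'.d s (L.compMultilinearMap f) = 0 := by
  rw [d_comp hL hf, hdf]
  ext
  simp

lemma comp_mem_coboundaries {L : M →ₗ[k] M'} (hL : B.IsEquivariantOn B' L W)
    (hLgr : B.IsGradedMap B' L) (hW : W ≤ W'.comap L)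
    {f : MultilinearMap k (fun _ : Fin s => A) M} (hf : f ∈ B.coboundaries W s) :
    L.compMultilinearMap f ∈ B'.coboundaries W' s := by
  cases s with
  | zero =>
    rw [(Submodule.mem_bot k).1 hf]
    exact (Submodule.mem_bot k).2 (by ext; simp)
  | succ s =>
    obtain ⟨u, hu, rfl⟩ := hf
    exact ⟨_, comp_mem_cochains hLgr hW hu, d_comp hL hu.2⟩

lemma exists_mem_coboundaries_comp_eq {q : M →ₗ[k] M'} {σ : M' →ₗ[k] M}
    (hq : B.IsEquivariantOn B' q W) (hσgr : B'.IsGradedMap B σ) (hσW : W' ≤ W.comap σ)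
    (hqσ : ∀ m ∈ W', q (σ m) = m) {b' : MultilinearMap k (fun _ : Fin s => A) M'}
    (hb' : b' ∈ B'.coboundaries W' s) : ∃ b ∈ B.coboundaries W s, q.compMultilinearMap b = b' := by
  cases s with
  | zero =>
    obtain rfl := (Submodule.mem_bot k).1 hb'
    exact ⟨0, zero_mem _, by ext; simp⟩
  | succ s =>
    obtain ⟨u, hu, rfl⟩ := hb'
    have hσu := comp_mem_cochains hσgr hσW hu
    refine ⟨_, ⟨_, hσu, rfl⟩, ?_⟩
    rw [← d_comp hq hσu.2]
    congr 1
    ext a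
    exact hqσ _ (hu.2 a)

lemma exists_mem_coboundaries_sub_mem_inf_ker {q : M →ₗ[k] M'} {σ : M' →ₗ[k] M}
    (hW : B.IsSubbimodule W) (hq : B.IsEquivariantOn B' q W) (hσgr : B'.IsGradedMap B σ)
    (hσW : ∀ m, σ m ∈ W) (hqσ : ∀ m, q (σ m) = m) {f : MultilinearMap k (fun _ : Fin s => A) M}
    (hf : f ∈ B.cochains W s) (hqf : q.compMultilinearMap f ∈ B'.coboundaries ⊤ s) :
    ∃ b ∈ B.coboundaries W s, f - b ∈ B.cochains (W ⊓ q.ker) s := by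
  obtain ⟨b, hb, hqb⟩ := exists_mem_coboundaries_comp_eq hq hσgr (fun m _ => hσW m)
    (fun m _ => hqσ m) hqf
  have hfb := sub_mem hf (coboundaries_le_cochains hW hb)
  refine ⟨b, hb, hfb.1, fun a => ⟨hfb.2 a, ?_⟩⟩
  simpa [sub_eq_zero] using (congrArg (· a) hqb).symm

lemma acyclicBetween_bot_iff : B.AcyclicBetween ⊥ W s ↔
    ∀ f ∈ B.cochains W s, B.d s f = 0 → f ∈ B.coboundaries W s := by
  have hbot : B.cochains ⊥ s = ⊥ := eq_bot_iff.2 fun f hf => MultilinearMap.ext hf.2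
  simp only [AcyclicBetween, hbot, bot_sup_eq, Submodule.mem_bot, MultilinearMap.ext_iff,
    zero_apply]

lemma acyclicBetween_zero (h : ∀ m ∈ W₂, m ∈ B.gr 0 →
    (∀ a, B.left a m - B.right a m ∈ W₁) → m ∈ W₁) : B.AcyclicBetween W₁ W₂ 0 := by
  intro f hf hdf
  refine Submodule.mem_sup_left ⟨hf.1, fun a => ?_⟩
  rw [Subsingleton.elim a 0]
  exact h _ (hf.2 0) (by simpa using hf.1 0 0 (fun i => i.elim0)) fun a => hdf ![a]

namespace AcyclicBetween

lemma trans (h₁₂ : B.AcyclicBetween W₁ W₂ s) (h₂₃ : B.AcyclicBetween W₂ W₃ s) (h₁ : W₁ ≤ W₂)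
    (h₂ : W₂ ≤ W₃) : B.AcyclicBetween W₁ W₃ s := by
  intro f hf hdf
  obtain ⟨w, hw, b, hb, rfl⟩ := Submodule.mem_sup.1 (h₂₃ f hf fun a => h₁ (hdf a))
  have hdw (a) : B.d s w a ∈ W₁ := by
    simpa [d_eq_zero_of_mem_coboundaries hb] using hdf a
  obtain ⟨w', hw', b', hb', rfl⟩ := Submodule.mem_sup.1 (h₁₂ w hw hdw)
  exact add_mem (Submodule.add_mem_sup hw' (coboundaries_mono h₂ hb'))
    (Submodule.mem_sup_right hb)

/-- The part of the long exact sequence of `0 → W₂ / W₁ → W₃ / W₁ → W₃ / W₂ → 0` around the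
connecting map. -/
lemma connecting (h₁₃ : B.AcyclicBetween W₁ W₃ (s + 1)) (h₂₃ : B.AcyclicBetween W₂ W₃ s)
    (h₁ : W₁ ≤ W₂) (h₂ : W₂ ≤ W₃) : B.AcyclicBetween W₁ W₂ (s + 1) := by
  intro f hf hdf
  obtain ⟨w, hw, _, ⟨u, hu, rfl⟩, rfl⟩ := Submodule.mem_sup.1 (h₁₃ f (cochains_mono h₂ hf) hdf)
  have hdu (a) : B.d s u a ∈ W₂ := by
    simpa using sub_mem (hf.2 a) (h₁ (hw.2 a))
  obtain ⟨v, hv, b, hb, rfl⟩ := Submodule.mem_sup.1 (h₂₃ u hu hdu)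
  rw [map_add, d_eq_zero_of_mem_coboundaries hb, add_zero]
  exact Submodule.add_mem_sup hw ⟨v, hv, rfl⟩

/-- If `q` identifies `W₂ / W₁` with `W₂' / W₁'`, acyclicity descends along `q`. The section `σ`
need not be equivariant. -/
lemma of_quotient {q : M →ₗ[k] M'} {σ : M' →ₗ[k] M} (h : B'.AcyclicBetween W₁' W₂' s)
    (hW₂ : B.IsSubbimodule W₂) (hq : B.IsEquivariantOn B' q W₂) (hqgr : B.IsGradedMap B' q)
    (hσgr : B'.IsGradedMap B σ) (hqW₂ : W₂ ≤ W₂'.comap q) (hσW₂ : W₂' ≤ W₂.comap σ)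
    (hqσ : ∀ m ∈ W₂', q (σ m) = m) (hW₁ : ∀ m ∈ W₂, m ∈ W₁ ↔ q m ∈ W₁') :
    B.AcyclicBetween W₁ W₂ s := by
  intro f hf hdf
  have hdW₂ (a) : B.d s f a ∈ W₂ :=
    (coboundaries_le_cochains hW₂ (s := s + 1) ⟨f, hf, rfl⟩).2 a
  have hdqf (a) : B'.d s (q.compMultilinearMap f) a ∈ W₁' := by
    rw [d_comp hq hf.2]
    exact (hW₁ _ (hdW₂ a)).1 (hdf a)
  obtain ⟨w, hw, b', hb', hqf⟩ :=
    Submodule.mem_sup.1 (h _ (comp_mem_cochains hqgr hqW₂ hf) hdqf)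
  obtain ⟨b, hb, rfl⟩ := exists_mem_coboundaries_comp_eq hq hσgr hσW₂ hqσ hb'
  have hfb := sub_mem hf (coboundaries_le_cochains hW₂ hb)
  rw [← sub_add_cancel f b]
  refine Submodule.add_mem_sup ⟨hfb.1, fun a => (hW₁ _ (hfb.2 a)).2 ?_⟩ hb
  have hw_apply : w a = q (f a) - q (b a) := by
    rw [eq_sub_iff_add_eq]
    exact congrArg (· a) hqf
  simpa [hw_apply] using hw.2 a

lemma of_retract {i : M →ₗ[k] M'} {p : M' →ₗ[k] M} (h : B'.AcyclicBetween ⊥ W' s)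
    (hi : B.IsEquivariantOn B' i ⊤) (hp : B'.IsEquivariantOn B p W') (higr : B.IsGradedMap B' i)
    (hpgr : B'.IsGradedMap B p) (hiW : ∀ m, i m ∈ W') (hpi : ∀ m, p (i m) = m) :
    B.AcyclicBetween ⊥ ⊤ s := by
  rw [acyclicBetween_bot_iff] at h ⊢
  intro f hf hdf
  have hpif : f = p.compMultilinearMap (i.compMultilinearMap f) := by ext; simp [hpi]
  rw [hpif]
  exact comp_mem_coboundaries hp hpgr (fun _ _ => Submodule.mem_top)
    (h _ (comp_mem_cochains higr (fun m _ => hiW m) hf)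
      (d_comp_eq_zero hi (fun _ => trivial) hdf))

end AcyclicBetween

end GradedBimodule

/-- A character of the graded algebra `A = ⨁ 𝒜 d` which vanishes outside degree `0`. -/
structure GradedCharacter {k A : Type u} [CommRing k] [Ring A] [Algebra k A]
    (𝒜 : ℤ → Submodule k A) extends A →ₗ[k] k where
  map_mul : ∀ a b, toFun (a * b) = toFun a * toFun b
  eq_zero : ∀ {d a}, a ∈ 𝒜 d → d ≠ 0 → toFun a = 0

namespace GradedCharacter

variable {k A : Type u} [CommRing k] [Ring A] [Algebra k A] {𝒜 : ℤ → Submodule k A}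

instance : CoeFun (GradedCharacter 𝒜) (fun _ => A → k) := ⟨fun χ => χ.toLinearMap⟩

lemma apply_mul (χ : GradedCharacter 𝒜) (a b : A) : χ (a * b) = χ a * χ b := χ.map_mul a b

lemma apply_eq_zero (χ : GradedCharacter 𝒜) {d : ℤ} {a : A} (ha : a ∈ 𝒜 d) (hd : d ≠ 0) :
    χ a = 0 := χ.eq_zero ha hd

end GradedCharacter

namespace GradedBimodule

section Characters

variable {k A U : Type u} [CommRing k] [Ring A] [Algebra k A] [AddCommGroup U] [Module k U]
  {𝒜 : ℤ → Submodule k A}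

/-- The bimodule on which `A` acts from the left by `χ` and from the right by `ψ`, concentrated
in degree `D / 2`; it is zero in all degrees if `D` is odd. -/
def ofCharacters (χ ψ : GradedCharacter 𝒜) (D : ℤ) (U : Type u) [AddCommGroup U] [Module k U] :
    GradedBimodule 𝒜 U where
  left := χ.toLinearMap.smulRight LinearMap.id
  right := ψ.toLinearMap.smulRight LinearMap.id
  left_mul a b m := by simp [χ.apply_mul, mul_smul, smul_comm (χ a)]
  right_mul a b m := by simp [ψ.apply_mul, mul_smul, smul_comm (ψ a)]
  left_right a b m := by simp [smul_comm (χ a)]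
  gr e :=
    { carrier := {u | 2 * e ≠ D → u = 0}
      zero_mem' := fun _ => rfl
      add_mem' := fun ha hb h => by rw [ha h, hb h, add_zero]
      smul_mem' := fun c _ ha h => by rw [ha h, smul_zero] }
  left_mem {d e a u} ha hu h := by
    rcases eq_or_ne d 0 with rfl | hd
    · rw [hu (by simpa using h), map_zero]
    · simp [χ.apply_eq_zero ha hd]
  right_mem {d e a u} ha hu h := by
    rcases eq_or_ne d 0 with rfl | hd
    · rw [hu (by simpa using h), map_zero]
    · simp [ψ.apply_eq_zero ha hd]

variable {χ ψ : GradedCharacter 𝒜} {D : ℤ}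

@[simp] lemma ofCharacters_left (a : A) (u : U) :
    (ofCharacters χ ψ D U).left a u = χ a • u := rfl

@[simp] lemma ofCharacters_right (a : A) (u : U) :
    (ofCharacters χ ψ D U).right a u = ψ a • u := rfl

lemma mem_ofCharacters_gr {e : ℤ} {u : U} :
    u ∈ (ofCharacters χ ψ D U).gr e ↔ (2 * e ≠ D → u = 0) := Iff.rfl

end Characters

section FiniteDimensional

variable {k A U U' : Type u} [Field k] [Ring A] [Algebra k A] [AddCommGroup U] [Module k U]
  [AddCommGroup U'] [Module k U'] {𝒜 : ℤ → Submodule k A} {χ ψ : GradedCharacter 𝒜} {D : ℤ}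

lemma isGradedMap_ofCharacters (L : U →ₗ[k] U') :
    (ofCharacters χ ψ D U).IsGradedMap (ofCharacters χ ψ D U') L :=
  fun e m hm h => by rw [hm h, map_zero]

lemma isEquivariantOn_ofCharacters (L : U →ₗ[k] U') (W : Submodule k U) :
    (ofCharacters χ ψ D U).IsEquivariantOn (ofCharacters χ ψ D U') L W :=
  ⟨fun a m _ => by simp, fun a m _ => by simp⟩

variable [SetLike.GradedMul 𝒜]

/-- Since the actions are by scalars, every linear projection is equivariant. -/
lemma acyclicBetween_ofCharacters [FiniteDimensional k U] {s : ℕ}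
    (h : (ofCharacters χ ψ D k).AcyclicBetween ⊥ ⊤ s) {W₁ W₂ : Submodule k U} (hW : W₁ ≤ W₂) :
    (ofCharacters χ ψ D U).AcyclicBetween W₁ W₂ s := by
  rw [acyclicBetween_bot_iff] at h
  have htop (f) (hf : f ∈ (ofCharacters χ ψ D U).cochains ⊤ s)
      (hdf : (ofCharacters χ ψ D U).d s f = 0) : f ∈ (ofCharacters χ ψ D U).coboundaries ⊤ s := by
    let b := Module.finBasis k U
    have hsum : f = ∑ i, (LinearMap.toSpanSingleton k U (b i)).compMultilinearMap
        ((b.coord i).compMultilinearMap f) := by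
      ext a
      simp [b.sum_repr]
    rw [hsum]
    refine sum_mem fun i _ => ?_
    refine comp_mem_coboundaries (isEquivariantOn_ofCharacters _ _) (isGradedMap_ofCharacters _)
      (fun _ _ => Submodule.mem_top) (h _ (comp_mem_cochains (isGradedMap_ofCharacters _)
      le_top hf) (d_comp_eq_zero (isEquivariantOn_ofCharacters _ ⊤) (fun _ => trivial) hdf))
  have exists_isProj (W : Submodule k U) : ∃ p : U →ₗ[k] U, LinearMap.IsProj W p :=
    have ⟨p, hp⟩ := W.subtype.exists_leftInverse_of_injective W.ker_subtype
    ⟨W.subtype ∘ₗ p, fun _ => (p _).2,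
      fun w hw => congrArg W.subtype (LinearMap.congr_fun hp ⟨w, hw⟩)⟩
  obtain ⟨p₁, hp₁⟩ := exists_isProj W₁
  obtain ⟨p₂, hp₂⟩ := exists_isProj W₂
  intro f hf hdf
  have hf₁ := comp_mem_cochains (isGradedMap_ofCharacters p₁) (fun m _ => hp₁.map_mem m) hf
  have hcocycle : (ofCharacters χ ψ D U).d s (f - p₁.compMultilinearMap f) = 0 := by
    rw [map_sub, d_comp (isEquivariantOn_ofCharacters _ ⊤) fun _ => Submodule.mem_top]
    ext a
    simp [hp₁.map_id _ (hdf a)]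
  have hb := htop _ (cochains_mono le_top (sub_mem hf (cochains_mono hW hf₁))) hcocycle
  have hp₂f : p₂.compMultilinearMap (f - p₁.compMultilinearMap f) =
      f - p₁.compMultilinearMap f := by
    ext a
    exact hp₂.map_id _ (sub_mem (hf.2 a) (hW (hf₁.2 a)))
  rw [← add_sub_cancel (p₁.compMultilinearMap f) f, ← hp₂f]
  exact Submodule.add_mem_sup hf₁ (comp_mem_coboundaries (isEquivariantOn_ofCharacters _ _)
    (isGradedMap_ofCharacters _) (fun m _ => hp₂.map_mem m) hb)

end FiniteDimensional

end GradedBimodule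

section SelfCoefficients

variable {k A : Type u} [CommRing k] [Ring A] [Algebra k A] {𝒜 : ℤ → Submodule k A}

/-- The algebra `A` as a graded bimodule over itself, shifted by `t`, with the left action
twisted by the Koszul sign. -/
def selfBimodule (𝒜 : ℤ → Submodule k A) [GradedAlgebra 𝒜] (t : ℤ) : GradedBimodule 𝒜 A where
  left := LinearMap.mul k A ∘ₗ koszulSign 𝒜 t
  right := (LinearMap.mul k A).flip
  left_mul a b m := by simp [koszulSign_mul, mul_assoc]
  right_mul a b m := by simp [mul_assoc]
  left_right a b m := by simp [mul_assoc]
  gr e := 𝒜 (e + t)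
  left_mem ha hm := by
    rw [add_assoc, LinearMap.comp_apply, koszulSign_apply 𝒜 t ha, map_zsmul, LinearMap.smul_apply]
    exact zsmul_mem (SetLike.mul_mem_graded ha hm) _
  right_mem ha hm := by
    rw [add_right_comm]
    exact SetLike.mul_mem_graded hm ha

lemma differential_eq_d_selfBimodule [GradedAlgebra 𝒜] (t : ℤ) (s : ℕ) :
    differential 𝒜 t s = (selfBimodule 𝒜 t).d s := by
  ext f a
  rw [GradedBimodule.d_apply]
  simp only [differential, LinearMap.coe_mk, AddHom.coe_mk, add_apply, sum_apply, smul_apply,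
    firstFace_apply, innerFace_apply, lastFace_apply]
  rfl

lemma subsingleton_cohomology [GradedAlgebra 𝒜] {t : ℤ} {s : ℕ}
    (h : (selfBimodule 𝒜 t).AcyclicBetween ⊥ ⊤ s) : Subsingleton (cohomology 𝒜 t s) := by
  have hcochains (s) : homogeneousCochains 𝒜 t s = (selfBimodule 𝒜 t).cochains ⊤ s :=
    le_antisymm (fun f hf => ⟨hf, fun _ => trivial⟩) fun f hf => hf.1
  rw [GradedBimodule.acyclicBetween_bot_iff, ← hcochains, ← differential_eq_d_selfBimodule] at h
  rw [Submodule.Quotient.subsingleton_iff, eq_top_iff]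
  rintro ⟨f, hf, hdf⟩ -
  have hfb := h f hf hdf
  cases s with
  | zero => exact hfb
  | succ s =>
    rwa [GradedBimodule.coboundaries, ← hcochains, ← differential_eq_d_selfBimodule] at hfb

end SelfCoefficients

namespace GradedBimodule

variable {k A M : Type u} [CommRing k] [Ring A] [Algebra k A] [AddCommGroup M] [Module k M]
  {𝒜 : ℤ → Submodule k A}

/-- The `2`-cochain `F` as a bilinear map. -/
def toBilin (F : MultilinearMap k (fun _ : Fin 2 => A) M) : A →ₗ[k] A →ₗ[k] M :=
  (MultilinearMap.ofSubsingletonₗ k k A M (0 : Fin 1)).symm.toLinearMap ∘ₗ F.curryLeft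

lemma toBilin_apply (F : MultilinearMap k (fun _ : Fin 2 => A) M) (a b : A) :
    toBilin F a b = F ![a, b] := by
  refine congrArg F (funext fun i => ?_)
  fin_cases i <;> rfl

lemma toBilin_injective : Function.Injective
    (toBilin : MultilinearMap k (fun _ : Fin 2 => A) M → A →ₗ[k] A →ₗ[k] M) :=
  fun F F' h => by
    ext m
    have hm : m = ![m 0, m 1] := funext fun i => by fin_cases i <;> rfl
    rw [hm, ← toBilin_apply, ← toBilin_apply, h]

lemma ofSubsingleton_mem_cochains {B : GradedBimodule 𝒜 M} {u : A →ₗ[k] M}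
    (hu : ∀ d, ∀ a ∈ 𝒜 d, u a ∈ B.gr d) :
    MultilinearMap.ofSubsingleton k A M 0 u ∈ B.cochains ⊤ 1 :=
  ⟨fun d a ha => by simpa using hu _ _ (ha 0), fun _ => trivial⟩

lemma toBilin_mem_gr {B : GradedBimodule 𝒜 M} {F : MultilinearMap k (fun _ : Fin 2 => A) M}
    (hF : F ∈ B.cochains ⊤ 2) {d d' : ℤ} {a b : A} (ha : a ∈ 𝒜 d) (hb : b ∈ 𝒜 d') :
    toBilin F a b ∈ B.gr (d + d') := by
  rw [toBilin_apply]
  simpa using hF.1 ![d, d'] ![a, b] (by simp [Fin.forall_fin_two, ha, hb])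

variable [SetLike.GradedMul 𝒜]

lemma d_one_apply (B : GradedBimodule 𝒜 M) (u : MultilinearMap k (fun _ : Fin 1 => A) M)
    (a b : A) : B.d 1 u ![a, b] = B.left a (u ![b]) - u ![a * b] + B.right b (u ![a]) := by
  have h := B.hom.d_zero_apply u.curryRight (Fin.init ![a, b])
  rw [d_succ_apply, h]
  simp [Fin.init, ← sub_add]

lemma d_two_apply (B : GradedBimodule 𝒜 M) (F : MultilinearMap k (fun _ : Fin 2 => A) M)
    (a b c : A) : B.d 2 F ![a, b, c] =
      B.left a (F ![b, c]) - F ![a * b, c] + F ![a, b * c] - B.right c (F ![a, b]) := by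
  have h := B.hom.d_one_apply F.curryRight a b
  have snoc_one (x y : A) : (Fin.snoc ![x] y : Fin 2 → A) = ![x, y] := by
    ext i
    fin_cases i <;> rfl
  have init_three : (Fin.init ![a, b, c] : Fin 2 → A) = ![a, b] := by
    ext i
    fin_cases i <;> rfl
  rw [d_succ_apply, init_three, h]
  simp only [Nat.reduceAdd, Fin.reduceLast, Matrix.cons_val, LinearMap.add_apply,
    LinearMap.sub_apply, hom_left_apply, hom_right_apply, MultilinearMap.curryRight_apply, snoc_one]
  abel

lemma toBilin_d (B : GradedBimodule 𝒜 M) (u : A →ₗ[k] M) (a b : A) :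
    toBilin (B.d 1 (MultilinearMap.ofSubsingleton k A M 0 u)) a b =
      B.left a (u b) - u (a * b) + B.right b (u a) := by
  rw [toBilin_apply, d_one_apply]
  rfl

variable {χ : GradedCharacter 𝒜} {D : ℤ} {F : MultilinearMap k (fun _ : Fin 2 => A) k} {e : A}

lemma toBilin_cocycle {B : GradedBimodule 𝒜 M} {F : MultilinearMap k (fun _ : Fin 2 => A) M}
    (hF : B.d 2 F = 0) (a b c : A) :
    B.left a (toBilin F b c) - toBilin F (a * b) c + toBilin F a (b * c) -
      B.right c (toBilin F a b) = 0 := by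
  simp only [toBilin_apply, ← d_two_apply, hF, zero_apply]

lemma exists_toBilin_sub_d_eq (hF : F ∈ (ofCharacters χ χ D k).cochains ⊤ 2)
    (hdF : (ofCharacters χ χ D k).d 2 F = 0) (he : e ∈ 𝒜 0) (hχ : χ e = 1) :
    ∃ u ∈ (ofCharacters χ χ D k).cochains ⊤ 1, ∀ a b,
      toBilin (F - (ofCharacters χ χ D k).d 1 u) a b =
        toBilin F (e * a - χ a • e) (b * e - χ b • e) := by
  let β := toBilin F
  let p : A →ₗ[k] A := LinearMap.mulLeft k e - χ.toLinearMap.smulRight e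
  have p_apply (a) : p a = e * a - χ a • e := rfl
  have p_mem {d a} (ha : a ∈ 𝒜 d) : p a ∈ 𝒜 d := by
    have hea : e * a ∈ 𝒜 d := zero_add d ▸ SetLike.mul_mem_graded he ha
    rcases eq_or_ne d 0 with rfl | hd
    · exact sub_mem hea (Submodule.smul_mem _ _ he)
    · rwa [p_apply, χ.apply_eq_zero ha hd, zero_smul, sub_zero]
  -- contract with `e` first on the left, then on the right
  let u := β e + β.flip e ∘ₗ p
  refine ⟨_, ofSubsingleton_mem_cochains (u := u) fun d a ha => ?_, fun a b => ?_⟩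
  · have h₁ := toBilin_mem_gr hF he ha
    have h₂ := toBilin_mem_gr hF (p_mem ha) he
    rw [zero_add] at h₁
    rw [add_zero] at h₂
    exact add_mem h₁ h₂
  · have χp : χ (p a) = 0 := by simp [p_apply, χ.apply_mul, hχ]
    have pa_mul_b : p a * b = p (a * b) - χ a • p b := by
      simp [p_apply, χ.apply_mul, sub_mul, smul_sub, mul_assoc, smul_smul]
    have cocycle_left : β a b - β (e * a) b + β e (a * b) - χ b * β e a = 0 := by
      simpa [hχ] using toBilin_cocycle hdF e a b
    have cocycle_right : β (p a) (b * e) - β (p (a * b)) e + χ a * β (p b) e = β (p a) b := by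
      have h := toBilin_cocycle hdF (p a) b e
      simp only [ofCharacters_left, ofCharacters_right, χp, hχ, pa_mul_b, map_sub, map_smul,
        LinearMap.sub_apply, LinearMap.smul_apply, smul_eq_mul, zero_mul, one_mul] at h
      linear_combination h
    have hpab : β (p a) b = β (e * a) b - χ a * β e b := by simp [p_apply]
    have hsub : toBilin (F - (ofCharacters χ χ D k).d 1 (.ofSubsingleton k A k 0 u)) a b =
        β a b - (χ a * u b - u (a * b) + χ b * u a) := by
      rw [toBilin_apply, sub_apply, ← toBilin_apply, ← toBilin_apply, toBilin_d]
      rfl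
    rw [hsub, ← p_apply, map_sub, map_smul]
    simp only [u, LinearMap.add_apply, LinearMap.comp_apply, LinearMap.flip_apply, smul_eq_mul]
    linear_combination cocycle_left - cocycle_right - hpab

lemma mem_coboundaries_of_toBilin_eq (hF : F ∈ (ofCharacters χ χ D k).cochains ⊤ 2)
    (hdF : (ofCharacters χ χ D k).d 2 F = 0) (he : e ∈ 𝒜 0) (hχ : χ e = 1) {w : A →ₗ[k] k}
    (hw : ∀ d, ∀ a ∈ 𝒜 d, w a ∈ (ofCharacters χ χ D k).gr d)
    (hFw : ∀ a b, toBilin F (e * a - χ a • e) (b * e - χ b • e) =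
      χ a * w b - w (a * b) + χ b * w a) :
    F ∈ (ofCharacters χ χ D k).coboundaries ⊤ 2 := by
  obtain ⟨u, hu, hFu⟩ := exists_toBilin_sub_d_eq hF hdF he hχ
  refine ⟨_, add_mem hu (ofSubsingleton_mem_cochains hw), ?_⟩
  rw [map_add, ← eq_sub_iff_add_eq']
  refine toBilin_injective (LinearMap.ext₂ fun a b => ?_)
  rw [hFu, hFw, toBilin_d]
  rfl

end GradedBimodule

end Hochschild

open Hochschild Module GradedBimodule

namespace SphAlg

universe u

section Components

variable {k V : Type u} [CommRing k] [AddCommGroup V] [Module k V] {g : V →ₗ[k] V}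

/-- The identity of the object `X`. -/
@[simps] def eX (g : V →ₗ[k] V) : SphAlg g := ⟨1, 0, 0, 0, 0, 0⟩

/-- The identity of the object `Y`. -/
@[simps] def eY (g : V →ₗ[k] V) : SphAlg g := ⟨0, 1, 0, 0, 0, 0⟩

/-- The generator `ξ_X` of `Hom¹(X, X)`. -/
@[simps] def genX (g : V →ₗ[k] V) : SphAlg g := ⟨0, 0, 0, 0, 1, 0⟩

/-- The generator `ξ_Y` of `Hom¹(Y, Y)`. -/
@[simps] def genY (g : V →ₗ[k] V) : SphAlg g := ⟨0, 0, 0, 0, 0, 1⟩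

/-- The inclusion of `Hom(X, Y) = V`. -/
@[simps] def inclXY (g : V →ₗ[k] V) : V →ₗ[k] SphAlg g where
  toFun v := ⟨0, 0, v, 0, 0, 0⟩
  map_add' v w := by ext <;> simp
  map_smul' c v := by ext <;> simp

/-- The inclusion of `Hom(Y, X) = V^∨`. -/
@[simps] def inclYX (g : V →ₗ[k] V) : Dual k V →ₗ[k] SphAlg g where
  toFun φ := ⟨0, 0, 0, φ, 0, 0⟩
  map_add' φ ψ := by ext <;> simp
  map_smul' c φ := by ext <;> simp

/-- The projection to `Hom(X, Y) = V`. -/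
@[simps] def projXY (g : V →ₗ[k] V) : SphAlg g →ₗ[k] V where
  toFun := hXY
  map_add' := add_hXY
  map_smul' := smul_hXY

/-- The projection to `Hom(Y, X) = V^∨`. -/
@[simps] def projYX (g : V →ₗ[k] V) : SphAlg g →ₗ[k] Dual k V where
  toFun := hYX
  map_add' := add_hYX
  map_smul' := smul_hYX

/-- The coefficient of `ξ_X`. -/
@[simps] def coeffX (g : V →ₗ[k] V) : SphAlg g →ₗ[k] k where
  toFun := xiX
  map_add' := add_xiX
  map_smul' := smul_xiX

/-- The coefficient of `ξ_Y`. -/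
@[simps] def coeffY (g : V →ₗ[k] V) : SphAlg g →ₗ[k] k where
  toFun := xiY
  map_add' := add_xiY
  map_smul' := smul_xiY

/-- The character sending `a` to the coefficient of `e_X`. -/
def charX (g : V →ₗ[k] V) : GradedCharacter (grading g) where
  toFun := idX
  map_add' := add_idX
  map_smul' := smul_idX
  map_mul := mul_idX
  eq_zero ha hd := ((mem_grading.1 ha).1 hd).1

@[simp] lemma charX_apply (a : SphAlg g) : charX g a = a.idX := rfl

/-- The character sending `a` to the coefficient of `e_Y`. -/
def charY (g : V →ₗ[k] V) : GradedCharacter (grading g) where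
  toFun := idY
  map_add' := add_idY
  map_smul' := smul_idY
  map_mul := mul_idY
  eq_zero ha hd := ((mem_grading.1 ha).1 hd).2.1

@[simp] lemma charY_apply (a : SphAlg g) : charY g a = a.idY := rfl

lemma eq_sum_components (a : SphAlg g) : a = a.idX • eX g + a.idY • eY g + inclXY g a.hXY +
    inclYX g a.hYX + a.xiX • genX g + a.xiY • genY g := by
  ext <;> simp

lemma eX_mul_eX : eX g * eX g = eX g := by ext <;> simp

lemma eX_mul_eY : eX g * eY g = 0 := by ext <;> simp

lemma eY_mul_eX : eY g * eX g = 0 := by ext <;> simp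

lemma eY_mul_eY : eY g * eY g = eY g := by ext <;> simp

lemma inclXY_mul_eX (v : V) : inclXY g v * eX g = inclXY g v := by ext <;> simp

lemma eY_mul_inclXY (v : V) : eY g * inclXY g v = inclXY g v := by ext <;> simp

lemma inclYX_mul_eY (φ : Dual k V) : inclYX g φ * eY g = inclYX g φ := by ext <;> simp

lemma eX_mul_inclYX (φ : Dual k V) : eX g * inclYX g φ = inclYX g φ := by ext <;> simp

lemma genX_mul_eX : genX g * eX g = genX g := by ext <;> simp

lemma genY_mul_eY : genY g * eY g = genY g := by ext <;> simp

lemma eX_mem : eX g ∈ grading g 0 := by simp [mem_grading]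

lemma eY_mem : eY g ∈ grading g 0 := by simp [mem_grading]

lemma inclXY_mem (v : V) : inclXY g v ∈ grading g 0 := by simp [mem_grading]

lemma inclYX_mem (φ : Dual k V) : inclYX g φ ∈ grading g 1 := by simp [mem_grading]

lemma genX_mem : genX g ∈ grading g 1 := by simp [mem_grading]

lemma genY_mem : genY g ∈ grading g 1 := by simp [mem_grading]

lemma inclYX_mul_inclXY (φ : Dual k V) (v : V) : inclYX g φ * inclXY g v = φ (g v) • genX g := by
  ext <;> simp

lemma inclXY_mul_inclYX (φ : Dual k V) (v : V) : inclXY g v * inclYX g φ = φ v • genY g := by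
  ext <;> simp

/-- The left ideal generated by `H ⊆ Hom(X, Y)`, `K ⊆ Hom(Y, X)` and the `Hom¹(X, X)`,
`Hom¹(Y, Y)`. -/
def leftIdeal (g : V →ₗ[k] V) (H : Submodule k V) (K : Submodule k (Dual k V)) :
    Submodule k (SphAlg g) where
  carrier := {a | a.idX = 0 ∧ a.idY = 0 ∧ a.hXY ∈ H ∧ a.hYX ∈ K}
  zero_mem' := ⟨rfl, rfl, H.zero_mem, K.zero_mem⟩
  add_mem' ha hb := ⟨by simp [ha.1, hb.1], by simp [ha.2.1, hb.2.1],
    H.add_mem ha.2.2.1 hb.2.2.1, K.add_mem ha.2.2.2 hb.2.2.2⟩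
  smul_mem' c _ ha := ⟨by simp [ha.1], by simp [ha.2.1], H.smul_mem c ha.2.2.1,
    K.smul_mem c ha.2.2.2⟩

variable {H H' : Submodule k V} {K K' : Submodule k (Dual k V)}

lemma mem_leftIdeal {a : SphAlg g} :
    a ∈ leftIdeal g H K ↔ a.idX = 0 ∧ a.idY = 0 ∧ a.hXY ∈ H ∧ a.hYX ∈ K := Iff.rfl

lemma leftIdeal_mono (hH : H' ≤ H) (hK : K' ≤ K) : leftIdeal g H' K' ≤ leftIdeal g H K :=
  fun _ ha => ⟨ha.1, ha.2.1, hH ha.2.2.1, hK ha.2.2.2⟩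

lemma mul_mem_leftIdeal (a : SphAlg g) {b : SphAlg g} (hb : b ∈ leftIdeal g H K) :
    a * b ∈ leftIdeal g H K := by
  obtain ⟨h₁, h₂, h₃, h₄⟩ := hb
  simp [mem_leftIdeal, h₁, h₂, H.smul_mem _ h₃, K.smul_mem _ h₄]

lemma mem_dualAnnihilator_leftIdeal {φ : Dual k (SphAlg g)} :
    φ ∈ (leftIdeal g H K).dualAnnihilator ↔
      (∀ v ∈ H, φ (inclXY g v) = 0) ∧ (∀ ψ ∈ K, φ (inclYX g ψ) = 0) ∧
        φ (genX g) = 0 ∧ φ (genY g) = 0 := by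
  rw [Submodule.mem_dualAnnihilator]
  refine ⟨fun h => ⟨fun v hv => h _ ?_, fun ψ hψ => h _ ?_, h _ ?_, h _ ?_⟩, ?_⟩
  · simp [mem_leftIdeal, hv]
  · simp [mem_leftIdeal, hψ]
  · simp [mem_leftIdeal]
  · simp [mem_leftIdeal]
  · rintro ⟨hH, hK, hX, hY⟩ a ⟨h₁, h₂, h₃, h₄⟩
    rw [eq_sum_components a]
    simp [h₁, h₂, hH _ h₃, hK _ h₄, hX, hY]

/-- The dual of the left regular module of `SphAlg g`, with `A` acting from the left through the
character `χ`. The functionals on the morphisms out of `X` are shifted to degree `D / 2`, those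
on the morphisms out of `Y` to degree `(D + 1) / 2`, which makes `a ↦ φ (a u)` homogeneous for
`u ∈ Hom(X, Y) ⊕ Hom(Y, X)`. -/
def dual (χ : GradedCharacter (grading g)) (D : ℤ) :
    GradedBimodule (grading g) (Dual k (SphAlg g)) where
  left := χ.toLinearMap.smulRight LinearMap.id
  right := LinearMap.mk₂ k (fun a φ => (LinearMap.mulLeft k a).dualMap φ)
    (fun a b φ => by ext; simp [add_mul]) (fun c a φ => by ext; simp)
    (fun a φ ψ => by ext; simp) (fun c a φ => by ext; simp)
  left_mul a b φ := by simp [χ.apply_mul, mul_smul, smul_comm (χ a)]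
  right_mul a b φ := by ext; simp
  left_right a b φ := by ext; simp
  gr e :=
    { carrier := {φ | ∀ d, ∀ a ∈ grading g d, (2 * (e + d) ≠ D → φ (a * eX g) = 0) ∧
        (2 * (e + d) ≠ D + 1 → φ (a * eY g) = 0)}
      zero_mem' := fun _ _ _ => ⟨fun _ => rfl, fun _ => rfl⟩
      add_mem' := fun h h' d a ha =>
        ⟨fun hd => by simp [(h d a ha).1 hd, (h' d a ha).1 hd],
          fun hd => by simp [(h d a ha).2 hd, (h' d a ha).2 hd]⟩
      smul_mem' := fun c _ h d a ha =>
        ⟨fun hd => by simp [(h d a ha).1 hd], fun hd => by simp [(h d a ha).2 hd]⟩ }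
  left_mem {d e a φ} ha hφ b x hx := by
    rcases eq_or_ne d 0 with rfl | hd
    · rw [zero_add]
      exact ⟨fun h => by simp [(hφ b x hx).1 h], fun h => by simp [(hφ b x hx).2 h]⟩
    · simp [χ.apply_eq_zero ha hd]
  right_mem ha hφ b x hx := by
    have h := hφ _ _ (SetLike.mul_mem_graded ha hx)
    simpa [mul_assoc, add_assoc] using h

variable {χ : GradedCharacter (grading g)} {D e : ℤ}

@[simp] lemma dual_left (a : SphAlg g) (φ : Dual k (SphAlg g)) :
    (dual χ D).left a φ = χ a • φ := rfl

@[simp] lemma dual_right_apply (a b : SphAlg g) (φ : Dual k (SphAlg g)) :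
    (dual χ D).right a φ b = φ (a * b) := rfl

lemma mem_dual_gr {φ : Dual k (SphAlg g)} : φ ∈ (dual χ D).gr e ↔
    (2 * e ≠ D → φ (eX g) = 0 ∧ ∀ v, φ (inclXY g v) = 0) ∧ (2 * e ≠ D + 1 → φ (eY g) = 0) ∧
      (2 * e ≠ D - 1 → (∀ ψ, φ (inclYX g ψ) = 0) ∧ φ (genY g) = 0) ∧
        (2 * e ≠ D - 2 → φ (genX g) = 0) := by
  constructor
  · intro h
    refine ⟨fun he => ⟨?_, fun v => ?_⟩, fun he => ?_, fun he => ⟨fun ψ => ?_, ?_⟩, fun he => ?_⟩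
    · exact eX_mul_eX (g := g) ▸ (h 0 _ eX_mem).1 (by lia)
    · exact inclXY_mul_eX (g := g) v ▸ (h 0 _ (inclXY_mem v)).1 (by lia)
    · exact eY_mul_eY (g := g) ▸ (h 0 _ eY_mem).2 (by lia)
    · exact inclYX_mul_eY (g := g) ψ ▸ (h 1 _ (inclYX_mem ψ)).2 (by lia)
    · exact genY_mul_eY (g := g) ▸ (h 1 _ genY_mem).2 (by lia)
    · exact genX_mul_eX (g := g) ▸ (h 1 _ genX_mem).1 (by lia)
  · rintro ⟨h₁, h₂, h₃, h₄⟩ d a ha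
    obtain ⟨ha₀, ha₁⟩ := mem_grading.1 ha
    have mul_eX : a * eX g = a.idX • eX g + inclXY g a.hXY + a.xiX • genX g := by ext <;> simp
    have mul_eY : a * eY g = a.idY • eY g + inclYX g a.hYX + a.xiY • genY g := by ext <;> simp
    rw [mul_eX, mul_eY]
    rcases eq_or_ne d 0 with rfl | hd₀
    · obtain ⟨k₁, k₂, k₃⟩ := ha₁ (by simp)
      exact ⟨fun h => by simp [h₁ (by lia), k₂], fun h => by simp [h₂ (by lia), k₁, k₃]⟩
    rcases eq_or_ne d 1 with rfl | hd₁
    · obtain ⟨k₁, k₂, k₃⟩ := ha₀ (by simp)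
      exact ⟨fun h => by simp [h₄ (by lia), k₁, k₃], fun h => by simp [h₃ (by lia), k₂]⟩
    · simp [ha₀ hd₀, ha₁ hd₁]

end Components

section DualCommRing

variable {k V : Type u} [CommRing k] [AddCommGroup V] [Module k V] {g : V →ₗ[k] V}
  {χ : GradedCharacter (grading g)} {D : ℤ} {s : ℕ}

variable (g) in
/-- A contraction `Ψ ↦ (n ↦ Ψ(n e_X)(e_X) + Ψ(n e_Y)(e_Y))` which witnesses that the right module
dual to `A` is relatively injective. -/
def contraction : (SphAlg g →ₗ[k] Dual k (SphAlg g)) →ₗ[k] Dual k (SphAlg g) :=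
  LinearMap.mk₂ k (fun Ψ n => Ψ (n * eX g) (eX g) + Ψ (n * eY g) (eY g))
    (fun Ψ Φ n => by simp [add_add_add_comm]) (fun c Ψ n => by simp [mul_add])
    (fun Ψ m n => by simp [add_mul, add_add_add_comm]) (fun c Ψ n => by simp [mul_add])

lemma contraction_apply (Ψ : SphAlg g →ₗ[k] Dual k (SphAlg g)) (n : SphAlg g) :
    contraction g Ψ n = Ψ (n * eX g) (eX g) + Ψ (n * eY g) (eY g) := rfl

lemma isGradedMap_contraction : (dual χ D).hom.IsGradedMap (dual χ D) (contraction g) := by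
  intro e Ψ hΨ d a ha
  have hX : a * eX g ∈ grading g d := by simpa using SetLike.mul_mem_graded ha eX_mem
  have hY : a * eY g ∈ grading g d := by simpa using SetLike.mul_mem_graded ha eY_mem
  simp only [contraction_apply, mul_assoc, eX_mul_eX, eX_mul_eY, eY_mul_eX, eY_mul_eY, mul_zero,
    map_zero, LinearMap.zero_apply, add_zero, zero_add]
  refine ⟨fun h => ?_, fun h => ?_⟩
  · simpa [eX_mul_eX] using (hΨ d _ hX 0 _ eX_mem).1 (by rwa [add_zero])
  · simpa [eY_mul_eY] using (hΨ d _ hY 0 _ eY_mem).2 (by rwa [add_zero])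

lemma contraction_left (a : SphAlg g) (Ψ : SphAlg g →ₗ[k] Dual k (SphAlg g)) :
    contraction g ((dual χ D).hom.left a Ψ) = (dual χ D).left a (contraction g Ψ) := by
  ext n
  simp [contraction_apply, mul_add]

lemma contraction_right (a : SphAlg g) (Ψ : SphAlg g →ₗ[k] Dual k (SphAlg g)) :
    contraction g ((dual χ D).hom.right a Ψ) = (dual χ D).right a (contraction g Ψ) - Ψ a := by
  ext n
  have h : Ψ a n = Ψ a (n * eX g * eX g) + Ψ a (n * eY g * eY g) := by
    rw [← map_add]
    congr 1
    ext <;> simp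
  simp only [contraction_apply, hom_right_apply, LinearMap.sub_apply,
    dual_right_apply, h, mul_assoc]
  ring

lemma acyclicBetween_bot_top_dual : (dual χ D).AcyclicBetween ⊥ ⊤ (s + 1) := by
  rw [acyclicBetween_bot_iff]
  intro f hf hdf
  let u := (contraction g).compMultilinearMap f.curryRight
  have hu : u ∈ (dual χ D).cochains ⊤ s := comp_mem_cochains
    isGradedMap_contraction (fun _ _ => Submodule.mem_top) (curryRight_mem_cochains hf)
  suffices hdu : (dual χ D).d s u = (-1 : ℤ) ^ (s + 1) • f by
    refine ⟨(-1 : ℤ) ^ (s + 1) • u, zsmul_mem hu _, ?_⟩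
    rw [map_zsmul, hdu, smul_smul, ← mul_pow]
    simp
  ext1 a
  have hcurry : (dual χ D).hom.d s f.curryRight a = 0 := by
    refine LinearMap.ext fun x => ?_
    simpa [d_succ_apply] using congrArg (· (Fin.snoc a x)) hdf
  have hcontr := congrArg (contraction g) hcurry
  rw [d_apply] at hcontr ⊢
  simp only [map_add, map_sum, map_zsmul, contraction_left, contraction_right, map_zero, smul_sub,
    MultilinearMap.curryRight_apply, Fin.snoc_init_self] at hcontr
  rw [← sub_eq_zero, ← hcontr]
  simp only [u, LinearMap.compMultilinearMap_apply, smul_apply]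
  abel

end DualCommRing

section Dual

variable {k V : Type u} [Field k] [AddCommGroup V] [Module k V] {g : V →ₗ[k] V}
  {χ : GradedCharacter (grading g)} {D : ℤ} {s : ℕ}
  {H H' : Submodule k V} {K K' : Submodule k (Dual k V)}

lemma isSubbimodule_dualAnnihilator_leftIdeal :
    (dual χ D).IsSubbimodule (leftIdeal g H K).dualAnnihilator where
  left_mem a _ hφ := Submodule.smul_mem _ (χ a) hφ
  right_mem a _ hφ := (Submodule.mem_dualAnnihilator _).2 fun _ hb =>
    (Submodule.mem_dualAnnihilator _).1 hφ _ (mul_mem_leftIdeal a hb)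

lemma eq_zero_of_mul_eq_self {c x : k} (h : c * x = x) (hx : c ≠ 0 → x = 0) : x = 0 := by
  rcases eq_or_ne c 0 with rfl | hc
  · rw [← h, zero_mul]
  · exact hx hc

/-- A functional on which `d` vanishes modulo the annihilator of the left ideal `R(H, K)` is zero
on the elements `e r = r` of `R(H, K)` because `φ(r) = φ(e r) = χ(e) φ(r)`, unless the degrees
match; and then on the products `ξ_X`, `ξ_Y` of two such elements. -/
lemma acyclicBetween_zero_top_dual (hg : Function.Injective g) (hX : χ (eX g) ≠ 0 → D ≠ 1)
    (hY : χ (eY g) ≠ 0 → D ≠ 0) (hH : H ≠ ⊥) (hK : K ≠ ⊥) :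
    (dual χ D).AcyclicBetween (leftIdeal g H K).dualAnnihilator ⊤ 0 := by
  refine acyclicBetween_zero fun φ _ hφ hdφ => ?_
  obtain ⟨hgrXY, -, hgrYX, -⟩ := mem_dual_gr.1 hφ
  have hχ (a) {r} (hr : r ∈ leftIdeal g H K) : χ a * φ r = φ (a * r) :=
    sub_eq_zero.1 ((Submodule.mem_dualAnnihilator _).1 (hdφ a) r hr)
  have mem_XY {v} (hv : v ∈ H) : inclXY g v ∈ leftIdeal g H K := by simp [mem_leftIdeal, hv]
  have mem_YX {ψ} (hψ : ψ ∈ K) : inclYX g ψ ∈ leftIdeal g H K := by simp [mem_leftIdeal, hψ]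
  have hXY {v} (hv : v ∈ H) : φ (inclXY g v) = 0 := by
    refine eq_zero_of_mul_eq_self (c := χ (eY g)) ?_ fun h => (hgrXY (hY h).symm).2 v
    rw [hχ _ (mem_XY hv), eY_mul_inclXY]
  have hYX {ψ} (hψ : ψ ∈ K) : φ (inclYX g ψ) = 0 := by
    refine eq_zero_of_mul_eq_self (c := χ (eX g)) ?_ fun h => (hgrYX (by have := hX h; lia)).1 ψ
    rw [hχ _ (mem_YX hψ), eX_mul_inclYX]
  refine mem_dualAnnihilator_leftIdeal.2 ⟨fun _ => hXY, fun _ => hYX, ?_, ?_⟩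
  · obtain ⟨v, hv, hv₀⟩ := H.exists_mem_ne_zero_of_ne_bot hH
    obtain ⟨ψ, hψ⟩ := Projective.exists_dual_eq_one k ((map_ne_zero_iff g hg).2 hv₀)
    simpa [inclYX_mul_inclXY, hψ, hXY hv] using (hχ (inclYX g ψ) (mem_XY hv)).symm
  · obtain ⟨ψ, hψ, hψ₀⟩ := K.exists_mem_ne_zero_of_ne_bot hK
    obtain ⟨v, hv⟩ := DFunLike.ne_iff.1 hψ₀
    have h : ψ v * φ (genY g) = 0 := by
      simpa [inclXY_mul_inclYX, hYX hψ] using (hχ (inclXY g v) (mem_YX hψ)).symm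
    exact (mul_eq_zero.1 h).resolve_left hv

lemma acyclicBetween_zero_bot_dual (hX : χ (eX g) ≠ 0 → D ≠ 0) (hY : χ (eY g) ≠ 0 → D ≠ -1) :
    (dual χ D).AcyclicBetween ⊥ (leftIdeal g ⊤ ⊤).dualAnnihilator 0 := by
  refine acyclicBetween_zero fun φ hφW hφ hdφ => ?_
  obtain ⟨hgrX, hgrY, -⟩ := mem_dual_gr.1 hφ
  have hχ (a r) : χ a * φ r = φ (a * r) := sub_eq_zero.1 (LinearMap.congr_fun (hdφ a) r)
  have heX : φ (eX g) = 0 := by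
    refine eq_zero_of_mul_eq_self (c := χ (eX g)) ?_ fun h => (hgrX (hX h).symm).1
    rw [hχ, eX_mul_eX]
  have heY : φ (eY g) = 0 := by
    refine eq_zero_of_mul_eq_self (c := χ (eY g)) ?_ fun h => hgrY (by have := hY h; lia)
    rw [hχ, eY_mul_eY]
  obtain ⟨hXY, hYX, hgenX, hgenY⟩ := mem_dualAnnihilator_leftIdeal.1 hφW
  refine (Submodule.mem_bot k).2 (LinearMap.ext fun a => ?_)
  rw [eq_sum_components a]
  simp [heX, heY, hXY, hYX, hgenX, hgenY]

/-- The cohomology of `R(H, K)^⊥` is, up to a shift, that of the quotient of the relatively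
injective module `A^*` by it. -/
lemma acyclicBetween_bot_dualAnnihilator
    (h : (dual χ D).AcyclicBetween (leftIdeal g H K).dualAnnihilator ⊤ s) :
    (dual χ D).AcyclicBetween ⊥ (leftIdeal g H K).dualAnnihilator (s + 1) :=
  acyclicBetween_bot_top_dual.connecting h bot_le le_top

section

variable (h : (dual χ D).AcyclicBetween ⊥ (leftIdeal g ⊤ ⊤).dualAnnihilator s)
include h

/-- The embedding `c ↦ c ψ` into `R(⊤, ⊤)^⊥` is split by evaluation at `e_X`. -/
lemma acyclicBetween_ofCharacters_charX_of_dual :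
    (ofCharacters χ (charX g) D k).AcyclicBetween ⊥ ⊤ s := by
  refine h.of_retract (i := LinearMap.toSpanSingleton k _ (charX g).toLinearMap)
    (p := Dual.eval k _ (eX g)) ⟨fun a c _ => ?_, fun a c _ => ?_⟩
    ⟨fun a φ _ => ?_, fun a φ hφ => ?_⟩ (fun e c hc => ?_) (fun e φ hφ he => ?_) (fun c => ?_)
    fun c => ?_
  · simp [mul_smul, smul_comm (χ a)]
  · ext b
    simp [mul_assoc, mul_left_comm]
  · simp
  · obtain ⟨hXY, -, hgenX, -⟩ := mem_dualAnnihilator_leftIdeal.1 hφ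
    have haX : a * eX g = a.idX • eX g + inclXY g a.hXY + a.xiX • genX g := by ext <;> simp
    simp [haX, hXY, hgenX]
  · rw [mem_dual_gr]
    rw [mem_ofCharacters_gr] at hc
    simp +contextual [hc]
  · exact ((mem_dual_gr.1 hφ).1 he).1
  · exact mem_dualAnnihilator_leftIdeal.2 (by simp)
  · simp

lemma acyclicBetween_ofCharacters_charY_of_dual :
    (ofCharacters χ (charY g) (D + 1) k).AcyclicBetween ⊥ ⊤ s := by
  refine h.of_retract (i := LinearMap.toSpanSingleton k _ (charY g).toLinearMap)
    (p := Dual.eval k _ (eY g)) ⟨fun a c _ => ?_, fun a c _ => ?_⟩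
    ⟨fun a φ _ => ?_, fun a φ hφ => ?_⟩ (fun e c hc => ?_) (fun e φ hφ he => ?_) (fun c => ?_)
    fun c => ?_
  · simp [mul_smul, smul_comm (χ a)]
  · ext b
    simp [mul_assoc, mul_left_comm]
  · simp
  · obtain ⟨-, hYX, -, hgenY⟩ := mem_dualAnnihilator_leftIdeal.1 hφ
    have haY : a * eY g = a.idY • eY g + inclYX g a.hYX + a.xiY • genY g := by ext <;> simp
    simp [haY, hYX, hgenY]
  · rw [mem_dual_gr]
    rw [mem_ofCharacters_gr] at hc
    simp +contextual [hc]
  · exact (mem_dual_gr.1 hφ).2.1 he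
  · exact mem_dualAnnihilator_leftIdeal.2 (by simp)
  · simp

end

end Dual

section Acyclic

variable {k V : Type u} [Field k] [AddCommGroup V] [Module k V] {g : V →ₗ[k] V}
  {χ : GradedCharacter (grading g)} {D : ℤ} {s : ℕ}
  {H H' : Submodule k V} {K K' : Submodule k (Dual k V)}

variable [FiniteDimensional k V]

lemma acyclicBetween_dualAnnihilator_XY (h : (ofCharacters χ (charY g) D k).AcyclicBetween ⊥ ⊤ s)
    (hH : H' ≤ H) : (dual χ D).AcyclicBetween (leftIdeal g H K).dualAnnihilator
      (leftIdeal g H' K).dualAnnihilator s := by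
  refine (acyclicBetween_ofCharacters h (Submodule.dualAnnihilator_anti hH)).of_quotient
    (q := (inclXY g).dualMap) (σ := (projXY g).dualMap) isSubbimodule_dualAnnihilator_leftIdeal
    ⟨fun a φ _ => ?_, fun a φ hφ => ?_⟩ (fun e φ hφ he => ?_) (fun e θ hθ => ?_) (fun φ hφ => ?_)
    (fun θ hθ => ?_) (fun θ _ => ?_) fun φ hφ => ?_
  · simp
  · ext v
    have hav : a * inclXY g v = a.idY • inclXY g v + a.hYX (g v) • genX g := by ext <;> simp
    simp [hav, (mem_dualAnnihilator_leftIdeal.1 hφ).2.2.1]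
  · exact LinearMap.ext ((mem_dual_gr.1 hφ).1 he).2
  · rw [mem_dual_gr]
    rw [mem_ofCharacters_gr] at hθ
    simp +contextual [hθ]
  · exact (Submodule.mem_dualAnnihilator _).2 (mem_dualAnnihilator_leftIdeal.1 hφ).1
  · exact mem_dualAnnihilator_leftIdeal.2 (by simpa using (Submodule.mem_dualAnnihilator _).1 hθ)
  · ext; simp
  · rw [mem_dualAnnihilator_leftIdeal] at hφ ⊢
    simpa [hφ.2.2, Submodule.mem_dualAnnihilator] using fun _ => hφ.2.1

lemma acyclicBetween_dualAnnihilator_YX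
    (h : (ofCharacters χ (charX g) (D - 1) k).AcyclicBetween ⊥ ⊤ s) (hK : K' ≤ K) :
    (dual χ D).AcyclicBetween (leftIdeal g H K).dualAnnihilator
      (leftIdeal g H K').dualAnnihilator s := by
  refine (acyclicBetween_ofCharacters h (Submodule.dualAnnihilator_anti hK)).of_quotient
    (q := (inclYX g).dualMap) (σ := (projYX g).dualMap) isSubbimodule_dualAnnihilator_leftIdeal
    ⟨fun a φ _ => ?_, fun a φ hφ => ?_⟩ (fun e φ hφ he => ?_) (fun e θ hθ => ?_) (fun φ hφ => ?_)
    (fun θ hθ => ?_) (fun θ _ => ?_) fun φ hφ => ?_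
  · simp
  · ext ψ
    have haψ : a * inclYX g ψ = a.idX • inclYX g ψ + ψ a.hXY • genY g := by ext <;> simp
    simp [haψ, (mem_dualAnnihilator_leftIdeal.1 hφ).2.2.2]
  · exact LinearMap.ext ((mem_dual_gr.1 hφ).2.2.1 he).1
  · rw [mem_dual_gr]
    rw [mem_ofCharacters_gr] at hθ
    simp +contextual [hθ]
  · exact (Submodule.mem_dualAnnihilator _).2 (mem_dualAnnihilator_leftIdeal.1 hφ).2.1
  · exact mem_dualAnnihilator_leftIdeal.2 (by simpa using (Submodule.mem_dualAnnihilator _).1 hθ)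
  · ext; simp
  · rw [mem_dualAnnihilator_leftIdeal] at hφ ⊢
    simpa [hφ.2.2, Submodule.mem_dualAnnihilator] using fun _ => hφ.1

omit [FiniteDimensional k V]

lemma mem_dualAnnihilator_leftIdeal_span {v₀ : V} {φ₀ : Dual k V} {φ : Dual k (SphAlg g)} :
    φ ∈ (leftIdeal g (k ∙ v₀) (k ∙ φ₀)).dualAnnihilator ↔ φ (inclXY g v₀) = 0 ∧
      φ (inclYX g φ₀) = 0 ∧ φ (genX g) = 0 ∧ φ (genY g) = 0 := by
  simp +contextual only [mem_dualAnnihilator_leftIdeal, Submodule.mem_span_singleton,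
    forall_exists_index, forall_apply_eq_imp_iff, map_smul, smul_eq_mul]
  exact and_congr ⟨fun h => by simpa using h 1, fun h c => by simp [h]⟩
    (and_congr_left' ⟨fun h => by simpa using h 1, fun h c => by simp [h]⟩)

lemma mul_inclXY_add_inclYX (a : SphAlg g) (v : V) (φ : Dual k V) :
    a * (inclXY g v + inclYX g φ) = a.idY • inclXY g v + a.idX • inclYX g φ +
      a.hYX (g v) • genX g + φ a.hXY • genY g := by
  ext <;> simp

/-- Right multiplication by `u = v₀ + φ₀` maps `A` onto `R(k v₀, k φ₀)`, and the preimage of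
zero is `R(ker φ₀, (g v₀)^⊥)`. -/
lemma acyclicBetween_dualAnnihilator_span (hg : Function.Injective g) {v₀ : V} {φ₀ : Dual k V}
    (hv₀ : v₀ ≠ 0) (hφ₀ : φ₀ ≠ 0)
    (h : (dual χ (D - 1)).AcyclicBetween ⊥
      (leftIdeal g φ₀.ker (Dual.eval k V (g v₀)).ker).dualAnnihilator s) :
    (dual χ D).AcyclicBetween (leftIdeal g (k ∙ v₀) (k ∙ φ₀)).dualAnnihilator ⊤ s := by
  obtain ⟨φ₁, hφ₁⟩ := Projective.exists_dual_eq_one k ((map_ne_zero_iff g hg).2 hv₀)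
  obtain ⟨v₁, hv₁⟩ : ∃ v₁, φ₀ v₁ = 1 := by
    obtain ⟨v, hv⟩ := DFunLike.ne_iff.1 hφ₀
    exact ⟨(φ₀ v)⁻¹ • v, by simpa using inv_mul_cancel₀ hv⟩
  let u := inclXY g v₀ + inclYX g φ₀
  let σ₀ := (Dual.eval k V v₁ ∘ₗ projYX g).smulRight (eX g) +
    (φ₁ ∘ₗ g ∘ₗ projXY g).smulRight (eY g) + (coeffY g).smulRight (inclXY g v₁) +
    (coeffX g).smulRight (inclYX g φ₁)
  have mul_u (a : SphAlg g) := mul_inclXY_add_inclYX a v₀ φ₀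
  refine h.of_quotient (q := (LinearMap.mulRight k u).dualMap) (σ := σ₀.dualMap)
    ⟨fun _ _ _ => trivial, fun _ _ _ => trivial⟩ ⟨fun a φ _ => ?_, fun a φ _ => ?_⟩
    (fun e φ hφ => ?_) (fun e θ hθ => ?_) (fun φ _ => ?_) le_top (fun θ hθ => ?_) fun φ _ => ?_
  · ext; simp
  · ext; simp [mul_assoc]
  · obtain ⟨hX, -, hY, hgenX⟩ := mem_dual_gr.1 hφ
    rw [mem_dual_gr]
    simp +contextual [u, mul_u, hX, hY, hgenX, sub_sub]
  · obtain ⟨hX, heY, hY, -⟩ := mem_dual_gr.1 hθ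
    rw [mem_dual_gr]
    simp +contextual [σ₀, hX, heY, hY, sub_sub]
  · refine mem_dualAnnihilator_leftIdeal.2 ?_
    simp +contextual [u, mul_u]
  · refine LinearMap.ext fun a => sub_eq_zero.1 ?_
    simp only [LinearMap.dualMap_apply, ← map_sub]
    refine (Submodule.mem_dualAnnihilator _).1 hθ _ ?_
    simp [mem_leftIdeal, σ₀, u, mul_u, hφ₁, hv₁, sub_eq_add_neg]
  · rw [mem_dualAnnihilator_leftIdeal_span]
    refine ⟨fun ⟨hXY, hYX, hX, hY⟩ => LinearMap.ext fun a => ?_, fun hφ => ?_⟩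
    · simp [u, mul_u, hXY, hYX, hX, hY]
    · have hφu (a) : φ (a * u) = 0 := LinearMap.congr_fun hφ a
      exact ⟨by simpa [u, mul_u] using hφu (eY g), by simpa [u, mul_u] using hφu (eX g),
        by simpa [u, mul_u, hφ₁] using hφu (inclYX g φ₁),
        by simpa [u, mul_u, hv₁] using hφu (inclXY g v₁)⟩

lemma ker_ne_bot_of_two_le_finrank {U : Type u} [AddCommGroup U] [Module k U]
    [FiniteDimensional k U] (hU : 2 ≤ finrank k U) (φ : Dual k U) : φ.ker ≠ ⊥ :=
  LinearMap.ker_ne_bot_of_finrank_lt (by rw [finrank_self]; lia)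

/-- The filtration `R(H, K)^⊥ ≤ R(H, k φ₀)^⊥ ≤ R(k v₀, k φ₀)^⊥ ≤ A^*` reduces the claim in degree
`s + 1` to the claim in degree `s`, with `D` decreased by one, for all three quotients. -/
lemma acyclicBetween_dualAnnihilator_top (hg : Function.Injective g) (hV : 2 ≤ finrank k V)
    (hX : χ (eX g) ≠ 0 → D ≠ s + 1) (hY : χ (eY g) ≠ 0 → D ≠ s) (hH : H ≠ ⊥) (hK : K ≠ ⊥) :
    (dual χ D).AcyclicBetween (leftIdeal g H K).dualAnnihilator ⊤ s := by
  have : FiniteDimensional k V := Module.finite_of_finrank_pos (by lia)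
  have : Nontrivial V := nontrivial_of_finrank_pos (R := k) (by lia)
  induction s generalizing D H K with
  | zero => exact acyclicBetween_zero_top_dual hg (by simpa using hX) (by simpa using hY) hH hK
  | succ s ih =>
    have ih' {H K} := ih (D := D - 1) (H := H) (K := K) (fun h => by have := hX h; lia)
      fun h => by have := hY h; lia
    obtain ⟨v₀, hv₀, hv₀_ne⟩ := H.exists_mem_ne_zero_of_ne_bot hH
    obtain ⟨φ₀, hφ₀, hφ₀_ne⟩ := K.exists_mem_ne_zero_of_ne_bot hK
    have hH' : k ∙ v₀ ≤ H := (Submodule.span_singleton_le_iff_mem _ _).2 hv₀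
    have hK' : k ∙ φ₀ ≤ K := (Submodule.span_singleton_le_iff_mem _ _).2 hφ₀
    have htop := acyclicBetween_bot_dualAnnihilator (ih' top_ne_bot top_ne_bot)
    have hcharX := acyclicBetween_ofCharacters_charX_of_dual htop
    have hcharY := acyclicBetween_ofCharacters_charY_of_dual htop
    rw [sub_add_cancel] at hcharY
    have hker := acyclicBetween_bot_dualAnnihilator (ih' (ker_ne_bot_of_two_le_finrank hV φ₀)
      (ker_ne_bot_of_two_le_finrank (by rwa [Subspace.dual_finrank_eq]) (Dual.eval k V (g v₀))))
    exact (acyclicBetween_dualAnnihilator_YX hcharX hK').trans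
      ((acyclicBetween_dualAnnihilator_XY hcharY hH').trans
        (acyclicBetween_dualAnnihilator_span hg hv₀_ne hφ₀_ne hker)
        (Submodule.dualAnnihilator_anti (leftIdeal_mono hH' le_rfl)) le_top)
      (Submodule.dualAnnihilator_anti (leftIdeal_mono le_rfl hK')) le_top

lemma acyclicBetween_bot_dualAnnihilator_top (hg : Function.Injective g) (hV : 2 ≤ finrank k V)
    (hX : χ (eX g) ≠ 0 → D ≠ s) (hY : χ (eY g) ≠ 0 → D ≠ s - 1) :
    (dual χ D).AcyclicBetween ⊥ (leftIdeal g ⊤ ⊤).dualAnnihilator s := by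
  have : FiniteDimensional k V := Module.finite_of_finrank_pos (by lia)
  have : Nontrivial V := nontrivial_of_finrank_pos (R := k) (by lia)
  cases s with
  | zero => exact acyclicBetween_zero_bot_dual (by simpa using hX) (by simpa using hY)
  | succ s =>
    exact acyclicBetween_bot_dualAnnihilator (acyclicBetween_dualAnnihilator_top hg hV
      (by simpa using hX) (by simpa using hY) top_ne_bot top_ne_bot)

lemma acyclicBetween_ofCharacters_charX (hg : Function.Injective g) (hV : 2 ≤ finrank k V)
    (hX : χ (eX g) ≠ 0 → D ≠ s) (hY : χ (eY g) ≠ 0 → D ≠ s - 1) :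
    (ofCharacters χ (charX g) D k).AcyclicBetween ⊥ ⊤ s :=
  acyclicBetween_ofCharacters_charX_of_dual
    (acyclicBetween_bot_dualAnnihilator_top hg hV hX hY)

lemma acyclicBetween_ofCharacters_charY (hg : Function.Injective g) (hV : 2 ≤ finrank k V)
    (hX : χ (eX g) ≠ 0 → D ≠ s + 1) (hY : χ (eY g) ≠ 0 → D ≠ s) :
    (ofCharacters χ (charY g) D k).AcyclicBetween ⊥ ⊤ s :=
  sub_add_cancel D 1 ▸ acyclicBetween_ofCharacters_charY_of_dual
    (acyclicBetween_bot_dualAnnihilator_top hg hV (fun h => by have := hX h; lia)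
      fun h => by have := hY h; lia)

end Acyclic

section SelfCoefficients

variable {k V : Type u} [CommRing k] [AddCommGroup V] [Module k V] {g : V →ₗ[k] V} {t : ℤ}

lemma koszulSign_eq (t : ℤ) (a : SphAlg g) : koszulSign (grading g) t a =
    part0 g a + (t.negOnePow : ℤ) • (part1 g a : SphAlg g) := by
  have ha : a = (part0 g a : SphAlg g) + part1 g a := by ext <;> simp [part0, part1]
  conv_lhs => rw [ha]
  rw [map_add, koszulSign_apply _ t (part0 g a).2, koszulSign_apply _ t (part1 g a).2]
  simp

@[simp] lemma koszulSign_idX (a : SphAlg g) : (koszulSign (grading g) t a).idX = a.idX := by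
  rw [koszulSign_eq]
  simp [part0, part1]

@[simp] lemma koszulSign_idY (a : SphAlg g) : (koszulSign (grading g) t a).idY = a.idY := by
  rw [koszulSign_eq]
  simp [part0, part1]

@[simp] lemma koszulSign_hXY (a : SphAlg g) : (koszulSign (grading g) t a).hXY = a.hXY := by
  rw [koszulSign_eq]
  simp [part0, part1]

@[simp] lemma koszulSign_hYX (a : SphAlg g) :
    (koszulSign (grading g) t a).hYX = (t.negOnePow : ℤ) • a.hYX := by
  rw [koszulSign_eq, ← projYX_apply, map_add, map_zsmul]
  simp [part0, part1]

@[simp] lemma selfBimodule_left (a m : SphAlg g) :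
    (selfBimodule (grading g) t).left a m = koszulSign (grading g) t a * m := rfl

@[simp] lemma selfBimodule_right (a m : SphAlg g) :
    (selfBimodule (grading g) t).right a m = m * a := rfl

variable (g t) in
lemma isEquivariantOn_charX : (selfBimodule (grading g) t).IsEquivariantOn
    (ofCharacters (charX g) (charX g) (-2 * t) k) (charX g).toLinearMap ⊤ :=
  ⟨fun a m _ => by simp, fun a m _ => by simp [mul_comm]⟩

variable (g t) in
lemma isEquivariantOn_charY : (selfBimodule (grading g) t).IsEquivariantOn
    (ofCharacters (charY g) (charY g) (-2 * t) k) (charY g).toLinearMap ⊤ :=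
  ⟨fun a m _ => by simp, fun a m _ => by simp [mul_comm]⟩

variable (g t) in
lemma isGradedMap_charX : (selfBimodule (grading g) t).IsGradedMap
    (ofCharacters (charX g) (charX g) (-2 * t) k) (charX g).toLinearMap :=
  fun _ _ hm he => (charX g).apply_eq_zero hm (by lia)

variable (g t) in
lemma isGradedMap_charY : (selfBimodule (grading g) t).IsGradedMap
    (ofCharacters (charY g) (charY g) (-2 * t) k) (charY g).toLinearMap :=
  fun _ _ hm he => (charY g).apply_eq_zero hm (by lia)

lemma isSubbimodule_leftIdeal (H : Submodule k V) (K : Submodule k (Dual k V)) :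
    (selfBimodule (grading g) t).IsSubbimodule (leftIdeal g H K) where
  left_mem a m hm := mul_mem_leftIdeal _ hm
  right_mem a m hm := by
    simp [mem_leftIdeal, hm.1, hm.2.1, H.smul_mem _ hm.2.2.1, K.smul_mem _ hm.2.2.2]

lemma isSubbimodule_span_genY :
    (selfBimodule (grading g) t).IsSubbimodule (k ∙ genY g) where
  left_mem a m hm := by
    obtain ⟨c, rfl⟩ := Submodule.mem_span_singleton.1 hm
    exact Submodule.mem_span_singleton.2 ⟨a.idY * c, by ext <;> simp [mul_comm]⟩
  right_mem a m hm := by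
    obtain ⟨c, rfl⟩ := Submodule.mem_span_singleton.1 hm
    exact Submodule.mem_span_singleton.2 ⟨c * a.idY, by ext <;> simp⟩

lemma mem_selfBimodule_gr {e : ℤ} {a : SphAlg g} : a ∈ (selfBimodule (grading g) t).gr e ↔
    (e + t ≠ 0 → a.idX = 0 ∧ a.idY = 0 ∧ a.hXY = 0) ∧
      (e + t ≠ 1 → a.hYX = 0 ∧ a.xiX = 0 ∧ a.xiY = 0) := mem_grading

end SelfCoefficients

section Acyclic

variable {k V : Type u} [Field k] [AddCommGroup V] [Module k V] {g : V →ₗ[k] V} {t : ℤ} {s : ℕ}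

lemma acyclicBetween_selfBimodule_leftIdeal (hg : Function.Injective g)
    (hV : 2 ≤ finrank k V) (hs : (s : ℤ) ≠ 1 - 2 * t) :
    (selfBimodule (grading g) t).AcyclicBetween (leftIdeal g ⊥ ⊥) (leftIdeal g ⊤ ⊤) s := by
  have : FiniteDimensional k V := Module.finite_of_finrank_pos (by lia)
  have acyclicXY : (selfBimodule (grading g) t).AcyclicBetween
      (leftIdeal g ⊥ ⊤) (leftIdeal g ⊤ ⊤) s :=
    (acyclicBetween_ofCharacters (U := V) (acyclicBetween_ofCharacters_charX (χ := charY g)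
      (D := -2 * t) hg hV (by simp) fun _ => by lia) (bot_le (a := ⊤))).of_quotient
      (q := projXY g) (σ := inclXY g) (isSubbimodule_leftIdeal _ _)
      ⟨fun a m hm => by simp [hm.1], fun a m hm => by simp [hm.2.1]⟩
      (fun e m hm he => ((mem_selfBimodule_gr.1 hm).1 (by lia)).2.2)
      (fun e v hv => mem_selfBimodule_gr.2 ⟨fun he => by simp [hv (by lia)], fun _ => by simp⟩)
      le_top (fun v _ => by simp [mem_leftIdeal]) (fun v _ => by simp)
      (fun m hm => by simp [mem_leftIdeal, hm.1, hm.2.1])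
  have acyclicYX : (selfBimodule (grading g) t).AcyclicBetween
      (leftIdeal g ⊥ ⊥) (leftIdeal g ⊥ ⊤) s :=
    (acyclicBetween_ofCharacters (U := Dual k V) (acyclicBetween_ofCharacters_charY (χ := charX g)
      (D := 2 - 2 * t) hg hV (fun _ => by lia) (by simp)) (bot_le (a := ⊤))).of_quotient
      (q := projYX g) (σ := inclYX g) (isSubbimodule_leftIdeal _ _)
      ⟨fun a m hm => by simp [hm.2.1], fun a m hm => by simp [hm.1]⟩
      (fun e m hm he => ((mem_selfBimodule_gr.1 hm).2 (by lia)).1)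
      (fun e φ hφ => mem_selfBimodule_gr.2 ⟨fun _ => by simp, fun he => by simp [hφ (by lia)]⟩)
      le_top (fun φ _ => by simp [mem_leftIdeal]) (fun φ _ => by simp)
      (fun m hm => by simp [mem_leftIdeal, hm.1, hm.2.1, (Submodule.mem_bot k).1 hm.2.2.1])
  exact acyclicYX.trans acyclicXY (leftIdeal_mono le_rfl bot_le) (leftIdeal_mono bot_le le_rfl)

lemma acyclicBetween_selfBimodule_leftIdeal_bot (hg : Function.Injective g)
    (hV : 2 ≤ finrank k V) (hs : (s : ℤ) ≠ 2 - 2 * t) :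
    (selfBimodule (grading g) t).AcyclicBetween ⊥ (leftIdeal g ⊥ ⊥) s := by
  have eq_zero {a : SphAlg g} (ha : a ∈ leftIdeal g ⊥ ⊥) : a.hXY = 0 ∧ a.hYX = 0 := ha.2.2
  have span_le : k ∙ genY g ≤ leftIdeal g ⊥ ⊥ := by simp [mem_leftIdeal]
  have acyclicX : (selfBimodule (grading g) t).AcyclicBetween
      (k ∙ genY g) (leftIdeal g ⊥ ⊥) s :=
    (acyclicBetween_ofCharacters_charX (χ := charX g) (D := 2 - 2 * t) hg hV (fun _ => by lia)
      (by simp)).of_quotient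
      (q := coeffX g) (σ := LinearMap.toSpanSingleton k _ (genX g)) (isSubbimodule_leftIdeal _ _)
      ⟨fun a m hm => by simp [hm.1, eq_zero hm], fun a m hm => by
        simp [hm.1, eq_zero hm, mul_comm]⟩
      (fun e m hm he => ((mem_selfBimodule_gr.1 hm).2 (by lia)).2.1)
      (fun e c hc => mem_selfBimodule_gr.2 ⟨fun _ => by simp, fun he => by simp [hc (by lia)]⟩)
      le_top (fun c _ => by simp [mem_leftIdeal]) (fun c _ => by simp) fun m hm => by
        rw [Submodule.mem_span_singleton]
        refine ⟨fun ⟨c, hc⟩ => by simp [← hc], fun h => ⟨m.xiY, ?_⟩⟩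
        ext <;> simp [hm.1, hm.2.1, eq_zero hm, show m.xiX = 0 from h]
  have acyclicY : (selfBimodule (grading g) t).AcyclicBetween ⊥ (k ∙ genY g) s :=
    (acyclicBetween_ofCharacters_charY (χ := charY g) (D := 2 - 2 * t) hg hV (by simp)
      (fun _ => by lia)).of_quotient
      (q := coeffY g) (σ := LinearMap.toSpanSingleton k _ (genY g)) isSubbimodule_span_genY
      ⟨fun a m hm => by simp [(span_le hm).2.1, eq_zero (span_le hm)], fun a m hm => by
        simp [(span_le hm).2.1, eq_zero (span_le hm), mul_comm]⟩
      (fun e m hm he => ((mem_selfBimodule_gr.1 hm).2 (by lia)).2.2)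
      (fun e c hc => mem_selfBimodule_gr.2 ⟨fun _ => by simp, fun he => by simp [hc (by lia)]⟩)
      le_top (fun c _ => by simp [Submodule.mem_span_singleton]) (fun c _ => by simp) fun m hm => by
        obtain ⟨c, rfl⟩ := Submodule.mem_span_singleton.1 hm
        refine ⟨fun h => ?_, fun h => ?_⟩
        · simpa using congrArg xiY ((Submodule.mem_bot k).1 h)
        · have hc : c = 0 := by simpa using h
          simp [hc]
  exact acyclicY.trans acyclicX bot_le span_le

lemma acyclicBetween_selfBimodule_bot_leftIdeal_top (hg : Function.Injective g)
    (hV : 2 ≤ finrank k V) (hs₁ : (s : ℤ) ≠ 1 - 2 * t) (hs₂ : (s : ℤ) ≠ 2 - 2 * t) :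
    (selfBimodule (grading g) t).AcyclicBetween ⊥ (leftIdeal g ⊤ ⊤) s :=
  (acyclicBetween_selfBimodule_leftIdeal_bot hg hV hs₂).trans
    (acyclicBetween_selfBimodule_leftIdeal hg hV hs₁) bot_le (leftIdeal_mono bot_le bot_le)

end Acyclic

section Criterion

variable {k V : Type u} [Field k] [AddCommGroup V] [Module k V] {g : V →ₗ[k] V} {t : ℤ} {s : ℕ}

lemma mem_coboundaries_selfBimodule (hg : Function.Injective g) (hV : 2 ≤ finrank k V)
    (hs₁ : (s : ℤ) ≠ 1 - 2 * t) (hs₂ : (s : ℤ) ≠ 2 - 2 * t)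
    {f : MultilinearMap k (fun _ : Fin s => SphAlg g) (SphAlg g)}
    (hf : f ∈ (selfBimodule (grading g) t).cochains ⊤ s)
    (hdf : (selfBimodule (grading g) t).d s f = 0)
    (hX : (charX g).compMultilinearMap f ∈
      (ofCharacters (charX g) (charX g) (-2 * t) k).coboundaries ⊤ s)
    (hY : (charY g).compMultilinearMap f ∈
      (ofCharacters (charY g) (charY g) (-2 * t) k).coboundaries ⊤ s) :
    f ∈ (selfBimodule (grading g) t).coboundaries ⊤ s := by
  have isSubbimodule_top : (selfBimodule (grading g) t).IsSubbimodule ⊤ :=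
    ⟨fun _ _ _ => trivial, fun _ _ _ => trivial⟩
  have isSubbimodule_ker : (selfBimodule (grading g) t).IsSubbimodule (charX g).ker :=
    ⟨fun a m hm => by simp_all, fun a m hm => by simp_all⟩
  have ker_inf_ker_le : (charX g).ker ⊓ (charY g).ker ≤ leftIdeal g ⊤ ⊤ :=
    fun a ha => ⟨ha.1, ha.2, trivial, trivial⟩
  obtain ⟨b, hb, hfb⟩ := exists_mem_coboundaries_sub_mem_inf_ker
    (σ := LinearMap.toSpanSingleton k _ (eX g)) isSubbimodule_top (isEquivariantOn_charX g t)
    (fun e c hc => mem_selfBimodule_gr.2 ⟨fun he => by simp [hc (by lia)], fun _ => by simp⟩)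
    (fun _ => trivial) (fun c => by simp) hf hX
  rw [top_inf_eq] at hfb
  have hfbY := sub_mem hY (comp_mem_coboundaries (isEquivariantOn_charY g t)
    (isGradedMap_charY g t) (W' := ⊤) (fun _ _ => trivial) hb)
  obtain ⟨b', hb', hfb'⟩ := exists_mem_coboundaries_sub_mem_inf_ker
    (σ := LinearMap.toSpanSingleton k _ (eY g)) isSubbimodule_ker
    ((isEquivariantOn_charY g t).mono le_top)
    (fun e c hc => mem_selfBimodule_gr.2 ⟨fun he => by simp [hc (by lia)], fun _ => by simp⟩)
    (fun c => by simp) (fun c => by simp) hfb (by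
      convert hfbY using 1
      ext
      exact map_sub (charY g).toLinearMap _ _)
  have hrad : f - b - b' ∈ (selfBimodule (grading g) t).cochains (leftIdeal g ⊤ ⊤) s :=
    cochains_mono ker_inf_ker_le hfb'
  have hd : (selfBimodule (grading g) t).d s (f - b - b') = 0 := by
    rw [map_sub, map_sub, hdf, d_eq_zero_of_mem_coboundaries hb,
      d_eq_zero_of_mem_coboundaries hb', sub_zero, sub_zero]
  have hfbb' := acyclicBetween_bot_iff.1
    (acyclicBetween_selfBimodule_bot_leftIdeal_top hg hV hs₁ hs₂) _ hrad hd
  rw [← sub_add_cancel f b, ← sub_add_cancel (f - b) b']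
  exact add_mem (add_mem (coboundaries_mono le_top hfbb') (coboundaries_mono le_top hb')) hb

lemma acyclicBetween_selfBimodule_bot_top (hg : Function.Injective g) (hV : 2 ≤ finrank k V)
    (hs₀ : (s : ℤ) ≠ -2 * t) (hs₁ : (s : ℤ) ≠ 1 - 2 * t) (hs₂ : (s : ℤ) ≠ 2 - 2 * t) :
    (selfBimodule (grading g) t).AcyclicBetween ⊥ ⊤ s := by
  have acyclicX := acyclicBetween_ofCharacters_charX (χ := charX g) (D := -2 * t) (s := s) hg hV
    (fun _ => by lia) (by simp)
  have acyclicY := acyclicBetween_ofCharacters_charY (χ := charY g) (D := -2 * t) (s := s) hg hV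
    (by simp) (fun _ => by lia)
  rw [acyclicBetween_bot_iff] at acyclicX acyclicY ⊢
  exact fun f hf hdf => mem_coboundaries_selfBimodule hg hV hs₁ hs₂ hf hdf
    (acyclicX _ (comp_mem_cochains (isGradedMap_charX g t) le_top hf)
      (d_comp_eq_zero (isEquivariantOn_charX g t) (fun _ => trivial) hdf))
    (acyclicY _ (comp_mem_cochains (isGradedMap_charY g t) le_top hf)
      (d_comp_eq_zero (isEquivariantOn_charY g t) (fun _ => trivial) hdf))

end Criterion

section CharacterCocycles

variable {k V : Type u} [Field k] [AddCommGroup V] [Module k V] {g : V →ₗ[k] V} {c : k}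
  {F : MultilinearMap k (fun _ : Fin 2 => SphAlg g) k}

lemma mem_coboundaries_charX [Nontrivial V] (hg : Function.Injective g)
    (hF : F ∈ (ofCharacters (charX g) (charX g) 2 k).cochains ⊤ 2)
    (hdF : (ofCharacters (charX g) (charX g) 2 k).d 2 F = 0)
    (hc : ∀ φ v, toBilin F (inclYX g φ) (inclXY g v) = c * φ (g v)) :
    F ∈ (ofCharacters (charX g) (charX g) 2 k).coboundaries ⊤ 2 := by
  have genX_inclXY (v) : toBilin F (genX g) (inclXY g v) = 0 := by
    obtain ⟨v₁, hv₁⟩ := exists_ne (0 : V)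
    obtain ⟨φ₁, hφ₁⟩ := Projective.exists_dual_eq_one k ((map_ne_zero_iff g hg).2 hv₁)
    have h := toBilin_cocycle hdF (inclYX g φ₁) (inclXY g v₁) (inclXY g v)
    have hvv : inclXY g v₁ * inclXY g v = 0 := by ext <;> simp
    simpa [inclYX_mul_inclXY, hφ₁, hvv] using h
  have inclYX_genX (φ) : toBilin F (inclYX g φ) (genX g) = 0 :=
    toBilin_mem_gr hF (inclYX_mem φ) genX_mem (by lia)
  have genX_genX : toBilin F (genX g) (genX g) = 0 :=
    toBilin_mem_gr hF genX_mem genX_mem (by lia)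
  have left_part (a : SphAlg g) : eX g * a - charX g a • eX g =
      inclYX g a.hYX + a.xiX • genX g := by ext <;> simp [sub_eq_add_neg]
  have right_part (b : SphAlg g) : b * eX g - charX g b • eX g =
      inclXY g b.hXY + b.xiX • genX g := by ext <;> simp [sub_eq_add_neg]
  refine mem_coboundaries_of_toBilin_eq hF hdF eX_mem (by simp) (w := -c • coeffX g)
    (fun d a ha hd => by simp [((mem_grading.1 ha).2 (by lia)).2.1]) fun a b => ?_
  rw [left_part, right_part]
  simp only [map_add, map_smul, LinearMap.add_apply, LinearMap.smul_apply, LinearMap.neg_apply,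
    hc, inclYX_genX, genX_inclXY, genX_genX, charX_apply, coeffX_apply, mul_xiX, neg_smul,
    smul_eq_mul]
  ring

lemma mem_coboundaries_charY [Nontrivial V]
    (hF : F ∈ (ofCharacters (charY g) (charY g) 2 k).cochains ⊤ 2)
    (hdF : (ofCharacters (charY g) (charY g) 2 k).d 2 F = 0)
    (hc : ∀ φ v, toBilin F (inclXY g v) (inclYX g φ) = c * φ v) :
    F ∈ (ofCharacters (charY g) (charY g) 2 k).coboundaries ⊤ 2 := by
  have inclXY_genY (v) : toBilin F (inclXY g v) (genY g) = 0 := by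
    obtain ⟨v₁, hv₁⟩ := exists_ne (0 : V)
    obtain ⟨φ₁, hφ₁⟩ := Projective.exists_dual_eq_one k hv₁
    have h := toBilin_cocycle hdF (inclXY g v) (inclXY g v₁) (inclYX g φ₁)
    have hvv : inclXY g v * inclXY g v₁ = 0 := by ext <;> simp
    simpa [inclXY_mul_inclYX, hφ₁, hvv] using h
  have genY_inclYX (φ) : toBilin F (genY g) (inclYX g φ) = 0 :=
    toBilin_mem_gr hF genY_mem (inclYX_mem φ) (by lia)
  have genY_genY : toBilin F (genY g) (genY g) = 0 :=
    toBilin_mem_gr hF genY_mem genY_mem (by lia)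
  have left_part (a : SphAlg g) : eY g * a - charY g a • eY g =
      inclXY g a.hXY + a.xiY • genY g := by ext <;> simp [sub_eq_add_neg]
  have right_part (b : SphAlg g) : b * eY g - charY g b • eY g =
      inclYX g b.hYX + b.xiY • genY g := by ext <;> simp [sub_eq_add_neg]
  refine mem_coboundaries_of_toBilin_eq hF hdF eY_mem (by simp) (w := -c • coeffY g)
    (fun d a ha hd => by simp [((mem_grading.1 ha).2 (by lia)).2.2]) fun a b => ?_
  rw [left_part, right_part]
  simp only [map_add, map_smul, LinearMap.add_apply, LinearMap.smul_apply, LinearMap.neg_apply,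
    hc, inclXY_genY, genY_inclYX, genY_genY, charY_apply, coeffY_apply, mul_xiY, neg_smul,
    smul_eq_mul]
  ring

end CharacterCocycles

section CocycleComponents

variable {k V : Type u} [Field k] [AddCommGroup V] [Module k V] {g : V →ₗ[k] V}
  {β γ : Dual k V →ₗ[k] Dual k V} {P Q : V → V} {φ : Dual k V} {v : V}

/-- The identities between the components of a `2`-cocycle `f` of degree `-1` on `SphAlg g`, where
`f(φ, v)` has `e_X`-component `β φ v`, `f(v, φ)` has `e_Y`-component `γ φ v`, and `P v` and `Q v`
are the `Hom(X, Y)`-components of `f(ξ_Y, v)` and `f(v, ξ_X)`. -/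
structure IsCocycleComponents (g : V →ₗ[k] V) (β γ : Dual k V →ₗ[k] Dual k V) (P Q : V → V) :
    Prop where
  smul_sub_smul : ∀ φ x y, β φ x • y - γ φ y • x = φ y • P x - φ (g x) • Q y
  eq_neg : ∀ φ v, φ v = 0 → φ (g v) = 0 → γ φ v = -β φ v

namespace IsCocycleComponents

lemma ker_le_span (h : IsCocycleComponents g β γ P Q) (hφ : φ (g v) = 0) (hβ : β φ v ≠ 0) :
    φ.ker ≤ k ∙ v := by
  intro y hy
  have hyv := h.smul_sub_smul φ v y
  rw [LinearMap.mem_ker.1 hy, hφ, zero_smul, zero_smul, sub_zero, sub_eq_zero] at hyv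
  rw [Submodule.mem_span_singleton]
  exact ⟨(β φ v)⁻¹ * γ φ y, by rw [mul_smul, ← hyv, inv_smul_smul₀ hβ]⟩

lemma apply_eq_zero_of_ne (hV : 2 ≤ finrank k V) (h : IsCocycleComponents g β γ P Q)
    (hφ : φ (g v) = 0) (hβ : β φ v ≠ 0) : φ v = 0 := by
  have : FiniteDimensional k V := Module.finite_of_finrank_pos (by lia)
  obtain ⟨y, hy, hy₀⟩ := Submodule.exists_mem_ne_zero_of_ne_bot
    (ker_ne_bot_of_two_le_finrank hV φ)
  obtain ⟨c, rfl⟩ := Submodule.mem_span_singleton.1 (h.ker_le_span hφ hβ hy)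
  exact (mul_eq_zero.1 (by simpa using hy)).resolve_left fun hc => hy₀ (by simp [hc])

lemma eq_of_ne (hV : 2 ≤ finrank k V) (h : IsCocycleComponents g β γ P Q)
    (hφ : φ (g v) = 0) (hβ : β φ v ≠ 0) : γ φ v = β φ v := by
  have hv := h.smul_sub_smul φ v v
  rw [h.apply_eq_zero_of_ne hV hφ hβ, hφ, zero_smul, zero_smul, sub_zero, ← sub_smul,
    smul_eq_zero, sub_eq_zero] at hv
  exact (hv.resolve_right fun hv₀ => hβ (by simp [hv₀])).symm

/-- All the relations below are the components with respect to the basis `v`, `w` of the relations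
between `f(φ, ·)` and `f(ψ, ·)` for `φ`, `ψ` its dual basis. -/
lemma apply_eq_of_dual_basis (h : IsCocycleComponents g β γ P Q) {ψ : Dual k V} {w : V} {c : k}
    (hβ : β φ v ≠ 0) (hγ : γ φ v = β φ v) (hφv : φ v = 0) (hφw : φ w = 1) (hψv : ψ v = 1)
    (hψw : ψ w = 0) (hgv : g v = c • v) : φ (g w) = c ∧ ψ (g w) = 0 := by
  have rel (φ' χ : Dual k V) (x y) := congrArg χ (h.smul_sub_smul φ' x y)
  simp only [map_sub, map_smul, smul_eq_mul] at rel
  have hφP : φ (P v) = β φ v := by simpa [hφv, hφw, hgv] using (rel φ φ v w).symm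
  have hφQ : c * φ (Q v) = β φ v := by
    have := rel ψ φ v v
    simp only [hφv, hψv, hgv, hφP, map_smul, smul_eq_mul] at this
    linear_combination this
  have hφQ' : φ (g w) * φ (Q v) = β φ v := by
    have := rel φ φ w v
    simp only [hφv, hφw, hγ] at this
    linear_combination this
  have hQ₀ : φ (Q v) ≠ 0 := right_ne_zero_of_mul (hφQ.trans_ne hβ)
  have hgw : φ (g w) = c := mul_right_cancel₀ hQ₀ (hφQ'.trans hφQ.symm)
  refine ⟨hgw, (mul_eq_zero.1 ?_).resolve_right hQ₀⟩
  have h₁ := rel ψ ψ v v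
  have h₂ := rel φ ψ v w
  have h₃ := rel φ ψ w v
  have h₄ := rel ψ φ w v
  have h₅ := rel ψ φ v w
  have h₆ := rel φ φ w w
  simp only [hφv, hφw, hψv, hψw, hgv, hgw, map_smul, smul_eq_mul] at h₁ h₂ h₃ h₄ h₅ h₆
  linear_combination -h₁ + h₂ + h₃ + h₄ + h₅ - h₆

lemma eq_smul_id_of_ne (hg : Function.Injective g) (hV : 2 ≤ finrank k V)
    (h : IsCocycleComponents g β γ P Q) (hφ : φ (g v) = 0) (hβ : β φ v ≠ 0) :
    ∃ c : kˣ, g = (c : k) • LinearMap.id := by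
  have hker {x : V} (hx : φ x = 0) : ∃ c : k, c • v = x :=
    Submodule.mem_span_singleton.1 (h.ker_le_span hφ hβ hx)
  have hφv := h.apply_eq_zero_of_ne hV hφ hβ
  obtain ⟨c, hgv⟩ := hker hφ
  obtain ⟨w, hφw⟩ : ∃ w, φ w = 1 :=
    LinearMap.surjective (f := φ) (fun hφ₀ => hβ (by simp [hφ₀])) 1
  obtain ⟨ψ₀, hψ₀⟩ := Projective.exists_dual_eq_one k (x := v) fun hv => hβ (by simp [hv])
  obtain ⟨hφgw, hψgw⟩ := h.apply_eq_of_dual_basis (ψ := ψ₀ - ψ₀ w • φ) hβ (h.eq_of_ne hV hφ hβ)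
    hφv hφw (by simp [hψ₀, hφv]) (by simp [hφw]) hgv.symm
  have hgw : g w = c • w := by
    obtain ⟨c', hc'⟩ := hker (x := g w - c • w) (by simp [hφgw, hφw])
    rw [sub_eq_iff_eq_add.1 hc'.symm] at hψgw
    have hc'₀ : c' = 0 := by simpa [hψ₀, hφv, hφw, mul_comm c] using hψgw
    rwa [hc'₀, zero_smul, eq_comm, sub_eq_zero] at hc'
  have hc : c ≠ 0 := by
    rintro rfl
    rw [zero_smul, eq_comm, map_eq_zero_iff g hg] at hgv
    exact hβ (by simp [hgv])
  refine ⟨.mk0 c hc, LinearMap.ext fun x => ?_⟩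
  obtain ⟨c', hc'⟩ := hker (x := x - φ x • w) (by simp [hφw])
  rw [sub_eq_iff_eq_add.1 hc'.symm]
  simp [← hgv, hgw, smul_comm c]

lemma apply_eq_zero_left (hg : Function.Injective g) (hV : 2 ≤ finrank k V)
    (hVg : 3 ≤ finrank k V ∨ (∀ c : kˣ, g ≠ (c : k) • LinearMap.id) ∨ ringChar k ≠ 2)
    (h : IsCocycleComponents g β γ P Q) (hφ : φ (g v) = 0) : β φ v = 0 := by
  by_contra hβ
  rcases hVg with hV₃ | hg_ne | hk
  · have : FiniteDimensional k V := Module.finite_of_finrank_pos (by lia)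
    have hker := Submodule.finrank_mono (h.ker_le_span hφ hβ)
    rw [finrank_span_singleton fun hv => hβ (by simp [hv])] at hker
    have hrank := Dual.finrank_ker_add_one_of_ne_zero (f := φ) fun hφ₀ => hβ (by simp [hφ₀])
    lia
  · obtain ⟨c, hc⟩ := h.eq_smul_id_of_ne hg hV hφ hβ
    exact hg_ne c hc
  · have hneg := h.eq_neg φ v (h.apply_eq_zero_of_ne hV hφ hβ) hφ
    rw [h.eq_of_ne hV hφ hβ] at hneg
    exact hβ ((Ring.eq_self_iff_eq_zero_of_char_ne_two hk).1 hneg.symm)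

lemma apply_eq_zero_right (hg : Function.Injective g) (hV : 2 ≤ finrank k V)
    (hVg : 3 ≤ finrank k V ∨ (∀ c : kˣ, g ≠ (c : k) • LinearMap.id) ∨ ringChar k ≠ 2)
    (h : IsCocycleComponents g β γ P Q) (hφ : φ v = 0) : γ φ v = 0 := by
  have : FiniteDimensional k V := Module.finite_of_finrank_pos (by lia)
  obtain ⟨x, hx, hx₀⟩ := Submodule.exists_mem_ne_zero_of_ne_bot
    (ker_ne_bot_of_two_le_finrank hV (φ ∘ₗ g))
  have hxv := h.smul_sub_smul φ x v
  rw [h.apply_eq_zero_left hg hV hVg hx, hφ, show φ (g x) = 0 from hx] at hxv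
  simpa [hx₀] using hxv

end IsCocycleComponents

lemma exists_forall_apply_eq_mul {T : Dual k V →ₗ[k] Dual k V}
    (hT : ∀ φ v, φ v = 0 → T φ v = 0) : ∃ c : k, ∀ φ v, T φ v = c * φ v := by
  obtain ⟨c, rfl⟩ : ∃ c : k, T = c • 1 := by
    refine LinearMap.exists_eq_smul_id_of_forall_notLinearIndependent fun φ hφ => ?_
    have hmem : T φ ∈ k ∙ φ := by
      simpa using mem_span_of_iInf_ker_le_ker (L := fun _ : Unit => φ) (K := T φ)
        (by simpa using show φ.ker ≤ (T φ).ker from fun v => hT φ v)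
    obtain ⟨c, hc⟩ := Submodule.mem_span_singleton.1 hmem
    have := LinearIndependent.pair_iff.1 hφ c (-1) (by simp [hc])
    simp at this
  exact ⟨c, fun φ v => rfl⟩

lemma IsCocycleComponents.exists_eq_mul_left (hg : Function.Injective g) (hV : 2 ≤ finrank k V)
    (hVg : 3 ≤ finrank k V ∨ (∀ c : kˣ, g ≠ (c : k) • LinearMap.id) ∨ ringChar k ≠ 2)
    (h : IsCocycleComponents g β γ P Q) : ∃ c : k, ∀ φ v, β φ v = c * φ (g v) := by
  have : FiniteDimensional k V := Module.finite_of_finrank_pos (by lia)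
  let g' := LinearEquiv.ofInjectiveEndo g hg
  have g_symm (v) : g (g'.symm v) = v := g'.apply_symm_apply v
  have symm_g (v) : g'.symm (g v) = v := g'.symm_apply_apply v
  obtain ⟨c, hc⟩ := exists_forall_apply_eq_mul (T := g'.symm.toLinearMap.dualMap ∘ₗ β)
    fun φ v hφ => show β φ (g'.symm v) = 0 from h.apply_eq_zero_left hg hV hVg (by rwa [g_symm])
  exact ⟨c, fun φ v => by simpa [symm_g] using hc φ (g v)⟩

lemma IsCocycleComponents.exists_eq_mul_right (hg : Function.Injective g) (hV : 2 ≤ finrank k V)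
    (hVg : 3 ≤ finrank k V ∨ (∀ c : kˣ, g ≠ (c : k) • LinearMap.id) ∨ ringChar k ≠ 2)
    (h : IsCocycleComponents g β γ P Q) : ∃ c : k, ∀ φ v, γ φ v = c * φ v :=
  exists_forall_apply_eq_mul fun _ _ => h.apply_eq_zero_right hg hV hVg

end CocycleComponents

section NegOne

variable {k V : Type u} [Field k] [AddCommGroup V] [Module k V] {g : V →ₗ[k] V}
  {f : MultilinearMap k (fun _ : Fin 2 => SphAlg g) (SphAlg g)} {c : k}

lemma isCocycleComponents_toBilin (hdf : (selfBimodule (grading g) (-1)).d 2 f = 0) :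
    IsCocycleComponents g
      (((toBilin f).compl₁₂ (inclYX g) (inclXY g)).compr₂ (charX g).toLinearMap)
      (((toBilin f).flip.compl₁₂ (inclYX g) (inclXY g)).compr₂ (charY g).toLinearMap)
      (fun v => (toBilin f (genY g) (inclXY g v)).hXY)
      (fun v => (toBilin f (inclXY g v) (genX g)).hXY) where
  smul_sub_smul φ x y := by
    have h := congrArg hXY (toBilin_cocycle hdf (inclXY g y) (inclYX g φ) (inclXY g x))
    rw [← sub_eq_zero]
    convert h.trans zero_hXY using 1
    simp only [LinearMap.compr₂_apply, LinearMap.compl₁₂_apply, LinearMap.flip_apply, charX_apply,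
      charY_apply, selfBimodule_left, selfBimodule_right, inclXY_mul_inclYX, inclYX_mul_inclXY,
      map_smul, LinearMap.smul_apply, sub_eq_add_neg, add_hXY, neg_hXY, mul_hXY, smul_hXY,
      koszulSign_idY, koszulSign_hXY, inclXY_apply_idX, inclXY_apply_idY, inclXY_apply_hXY,
      zero_smul, zero_add, add_zero]
    abel
  eq_neg φ v hφ hφg := by
    rcases eq_or_ne φ 0 with rfl | hφ₀
    · simp
    have h := congrArg hYX (toBilin_cocycle hdf (inclYX g φ) (inclXY g v) (inclYX g φ))
    have hsmul : -((toBilin f (inclXY g v) (inclYX g φ)).idY +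
        (toBilin f (inclYX g φ) (inclXY g v)).idX) • φ = 0 := by
      simpa [inclYX_mul_inclXY, inclXY_mul_inclYX, hφ, hφg, sub_eq_add_neg, neg_smul,
        add_smul, add_comm] using h
    exact eq_neg_of_add_eq_zero_left (neg_eq_zero.1 ((smul_eq_zero.1 hsmul).resolve_right hφ₀))

lemma charX_comp_mem_coboundaries [Nontrivial V] (hg : Function.Injective g)
    (hf : f ∈ (selfBimodule (grading g) (-1)).cochains ⊤ 2)
    (hdf : (selfBimodule (grading g) (-1)).d 2 f = 0)
    (hc : ∀ φ v, (toBilin f (inclYX g φ) (inclXY g v)).idX = c * φ (g v)) :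
    (charX g).compMultilinearMap f ∈
      (ofCharacters (charX g) (charX g) (-2 * -1) k).coboundaries ⊤ 2 :=
  mem_coboundaries_charX hg (comp_mem_cochains (isGradedMap_charX g (-1)) le_top hf)
    (d_comp_eq_zero (isEquivariantOn_charX g (-1)) (fun _ => trivial) hdf) hc

lemma charY_comp_mem_coboundaries [Nontrivial V]
    (hf : f ∈ (selfBimodule (grading g) (-1)).cochains ⊤ 2)
    (hdf : (selfBimodule (grading g) (-1)).d 2 f = 0)
    (hc : ∀ φ v, (toBilin f (inclXY g v) (inclYX g φ)).idY = c * φ v) :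
    (charY g).compMultilinearMap f ∈
      (ofCharacters (charY g) (charY g) (-2 * -1) k).coboundaries ⊤ 2 :=
  mem_coboundaries_charY (comp_mem_cochains (isGradedMap_charY g (-1)) le_top hf)
    (d_comp_eq_zero (isEquivariantOn_charY g (-1)) (fun _ => trivial) hdf) hc

lemma acyclicBetween_selfBimodule_neg_one (hg : Function.Injective g) (hV : 2 ≤ finrank k V)
    (hVg : 3 ≤ finrank k V ∨ (∀ c : kˣ, g ≠ (c : k) • LinearMap.id) ∨ ringChar k ≠ 2) :
    (selfBimodule (grading g) (-1)).AcyclicBetween ⊥ ⊤ 2 := by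
  have : Nontrivial V := nontrivial_of_finrank_pos (R := k) (by lia)
  rw [acyclicBetween_bot_iff]
  intro f hf hdf
  have hcomponents := isCocycleComponents_toBilin hdf
  obtain ⟨c, hc⟩ := hcomponents.exists_eq_mul_left hg hV hVg
  obtain ⟨c', hc'⟩ := hcomponents.exists_eq_mul_right hg hV hVg
  exact mem_coboundaries_selfBimodule hg hV (by simp) (by simp) hf hdf
    (charX_comp_mem_coboundaries hg hf hdf hc) (charY_comp_mem_coboundaries hf hdf hc')

end NegOne

end SphAlg

universe u in
theorem theorem1p5_general {k V : Type u} [Field k] [AddCommGroup V] [Module k V] {g : V →ₗ[k] V}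
    (hg : Function.Injective g) (hV : 2 ≤ finrank k V) :
    (∀ m t : ℤ, m + t ≠ 0 → m + t ≠ 1 → m + t ≠ 2 →
      Subsingleton (HH (SphAlg.grading g) m t)) ∧
    ((3 ≤ finrank k V ∨ (∀ c : kˣ, g ≠ (c : k) • LinearMap.id) ∨ ringChar k ≠ 2) →
      Subsingleton (HH (SphAlg.grading g) 1 (-1))) := by
  refine ⟨fun m t h₀ h₁ h₂ => ?_, fun hVg =>
    subsingleton_cohomology (SphAlg.acyclicBetween_selfBimodule_neg_one hg hV hVg)⟩
  rw [HH]
  split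
  · next s hs =>
    replace hs : m - t = s := hs
    exact subsingleton_cohomology
      (SphAlg.acyclicBetween_selfBimodule_bot_top hg hV (by lia) (by lia) (by lia))
  · infer_instance

theorem theorem1p5 {k : Type*} [Field k] (n : ℕ) (hn : 2 ≤ n) (g : GL (Fin n) k) :
    (∀ m t : ℤ, t < -m →
      Subsingleton
        (Hochschild.HH (SphAlg.grading (Matrix.toLin' (g : Matrix (Fin n) (Fin n) k))) m t)) ∧
    ((3 ≤ n ∨ (∀ c : kˣ, (g : Matrix (Fin n) (Fin n) k) ≠ (c : k) • 1) ∨ ringChar k ≠ 2) →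
      Subsingleton
        (Hochschild.HH (SphAlg.grading (Matrix.toLin' (g : Matrix (Fin n) (Fin n) k))) 1 (-1))) := by
  obtain ⟨hlow, hborderline⟩ := theorem1p5_general
    (g := Matrix.toLin' (g : Matrix (Fin n) (Fin n) k))
    (Matrix.mulVec_injective_of_isUnit g.isUnit) (by simpa using hn)
  refine ⟨fun m t hmt => hlow m t (by lia) (by lia) (by lia), fun h => hborderline <|
    h.imp (by simp) <| Or.imp_left fun hgc c hc => hgc c ?_⟩
  simpa using congrArg LinearMap.toMatrix' hc
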